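/- Let $(\mathfrak U,\iota,\tau)$ be a short-range quantum spin lattice on $\mathbb Z^D$. That is: $\mathfrak U$ is the quasi-local C$^*$-algebra $\overline{\bigcup_\Lambda \mathfrak U_\Lambda}$, $\mathfrak U_\Lambda=\bigotimes_{x\in\Lambda}M_{N_x}(\mathbb C)$ for finite $\Lambda\subset\mathbb Z^D$, with $N_x\ge 1$ uniformly bounded; $\iota$ is a representation of $\mathbb Z^D$ by $*$-automorphisms with $\iota_x\mathfrak U_\Lambda\subset\mathfrak U_{\Lambda+x}$; $\tau$ is a strongly continuous representation of $\mathbb R$ by $*$-automorphisms commuting with $\iota$; and for local $A$, $\tau_t(A)=\lim_{\Lambda\to\mathbb Z^D}e^{itH_\Lambda}Ae^{-itH_\Lambda}$, $H_\Lambda=\sum_{X\subset\Lambda}\Phi(X)$, for an interaction $\Phi(X)=\Phi(X)^*\in\mathfrak U_X$ such that $$\sup_{x,y}\sum_{X\ni x,y}\frac{\|\Phi(X)\|}{e^{-\lambda d(x,y)}F(d(x,y))}<\infty$$ for some $\lambda>0$ and some $F:[0,\infty)\to(0,\infty)$ with $\sup_x\sum_yF(d(x,y))<\infty$ and $\sup_{x,y}\sum_z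 F(d(x,z))F(d(z,y))/F(d(x,y))<\infty$, where $d$ is the $\ell^1$ distance. For local $A$ let $\Lambda_A$ be its support (the intersection of all finite $X$ with $A\in\mathfrak U_X$), $|\Lambda_A|$ its cardinality, $\mathrm{dist}$ the $\ell^1$ distance of supports, $A(x)=\iota_xA$ and $A(x,t)=\iota_x\tau_tA$; for a pair $A,C$ put $\Lambda_{AC}=\Lambda_A\cup\Lambda_C$ and $\mathrm{dist}(B,AC)=\mathrm{dist}(\Lambda_B,\Lambda_{AC})$. Call $\upsilon>0$ a Lieb–Robinson velocity of the system if there are $L,\lambda'>0$ with $$\|[\tau_t(A),B]\|\le L\|A\|\|B\|\min(|\Lambda_A|,|\Lambda_B|)\,e^{-\lambda'(\mathrm{dist}(A,B)-\upsilon|t|)}$$ for all local $A,B$ and all $t\in\mathbb R$. For a state $\omega$ the classical cumulants are $$c_n(A_1,\dots,A_n)=\sum_{\pi\in P(n)}(-1)^{|\pi|-1}(|\pi|-1)!\prod_{V\in\pi}\omega\Big(\prod_{i\in V}A_i\Big)$$ (products in increasing order of the indices), and the free cumulants $\kappa_n$ are defined recursively by $$\omega(A_1\cdots A_n)=\sum_{\pi\in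 NC(n)}\prod_{V\in\pi}\kappa_{|V|}\big((A_i)_{i\in V}\big),$$ where $P(n)$ and $NC(n)$ are the sets of all, respectively of the non-crossing, partitions of $\{1,\dots,n\}$. Then there is a Lieb–Robinson velocity $\upsilon_{LR}>0$ of the system such that the following holds. Let $p\in\mathbb R$, let $r\geq 0$ be an integer with $p-rD>1$, let $P_r$ be a real polynomial in two variables of total degree at most $r$, and let $u=u(\upsilon)>0$ for $\upsilon>\upsilon_{LR}$. For every $n\ge2$ and $\upsilon>\upsilon_{LR}$ there is a function $K:\mathbb N^n\to\mathbb R$, depending on the system, $\upsilon_{LR}$, $p,r,P_r,u,n,\upsilon$ only, with the following property. Let $\omega$ be any state such that, for all $\upsilon'>\upsilon_{LR}$, all $x\in\mathbb Z^D$, all local $A,B,C$ with $\Lambda_B$ and $\Lambda_{AC}$ non-empty, and all $t$ with $|t|\le\upsilon'^{-1}\mathrm{dist}(B(x),AC)$, $$|\omega(A\,B(x,t)\,C)-\omega(AC)\,\omega(B(x,t))|\le\frac{u(\upsilon')\,\|A\|\|B\|\|C\|\,P_r(|\Lambda_B|,|\Lambda_{AC}|)}{(1+\mathrm{dist}(B(x),AC))^{p}}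 .$$ Then for all local $A_1,\dots,A_n$ with non-empty supports and all $x_1,\dots,x_n\in\mathbb Z^D$, with $z=\max_i\min_{j\ne i}\mathrm{dist}(A_i(x_i),A_j(x_j))$, and all $t_1,\dots,t_n\in[-\upsilon^{-1}z+1,\;\upsilon^{-1}z-1]$, $$|c_n(A_1(x_1,t_1),\dots,A_n(x_n,t_n))|\le\frac{C_n}{(1+z)^{p-rD}},\qquad |\kappa_n(A_1(x_1,t_1),\dots,A_n(x_n,t_n))|\le\frac{C_n}{(1+z)^{p-rD}},$$ where $C_n=K(|\Lambda_{A_1}|,\dots,|\Lambda_{A_n}|)\prod_i\|A_i\|$. -/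

import Mathlib

open Filter Topology

namespace QSL

/-- The lattice `ℤ^D`. -/
abbrev Lattice (D : ℕ) : Type := Fin D → ℤ

/-- The `ℓ¹` distance on `ℤ^D`. -/
def latDist {D : ℕ} (x y : Lattice D) : ℕ := ∑ i, (x i - y i).natAbs

/-- The distance `min {|x - y|₁ : x ∈ X, y ∈ Y}` of two sets of lattice points
(with the junk value `0` if one of them is empty). -/
noncomputable def setDist {D : ℕ} (X Y : Set (Lattice D)) : ℕ :=
  sInf {k | ∃ x ∈ X, ∃ y ∈ Y, latDist x y = k}

/-- Spin configurations on a finite region `Λ`, with `N x` levels at the site `x`. They index the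
product basis of `⨂_{x ∈ Λ} ℂ^{N x}`. -/
abbrev Config {D : ℕ} (N : Lattice D → ℕ) (Λ : Finset (Lattice D)) : Type :=
  (x : {x // x ∈ Λ}) → Fin (N x.1)

/-- The algebra `⨂_{x ∈ Λ} M_{N x}(ℂ)`, as the matrices over the product basis. -/
abbrev SpinMatrix {D : ℕ} (N : Lattice D → ℕ) (Λ : Finset (Lattice D)) : Type :=
  Matrix (Config N Λ) (Config N Λ) ℂ

/-- Restriction of a configuration to a smaller region. -/
def Config.restrict {D : ℕ} {N : Lattice D → ℕ} {Λ₁ Λ₂ : Finset (Lattice D)} (h : Λ₁ ⊆ Λ₂)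
    (σ : Config N Λ₂) : Config N Λ₁ :=
  fun x => σ ⟨x.1, h x.2⟩

/-- The matrix `M ⊗ 1` on `Λ₂`, for a matrix `M` on the smaller region `Λ₁`. -/
def tensorOne {D : ℕ} {N : Lattice D → ℕ} {Λ₁ Λ₂ : Finset (Lattice D)} (h : Λ₁ ⊆ Λ₂)
    (M : SpinMatrix N Λ₁) : SpinMatrix N Λ₂ :=
  fun σ η => if ∀ x : {x // x ∈ Λ₂}, x.1 ∉ Λ₁ → σ x = η x then
    M (Config.restrict h σ) (Config.restrict h η) else 0

/-- The C⋆-algebra `𝔘` is the quasi-local algebra of a quantum spin lattice on `ℤ^D`: the norm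
completion of the direct limit of the matrix algebras `⨂_{x ∈ Λ} M_{N x}(ℂ)`, `Λ ⊂ ℤ^D` finite,
along the inclusions `M ↦ M ⊗ 1`. -/
structure QuasiLocalAlgebra (D : ℕ) (𝔘 : Type*) [CStarAlgebra 𝔘] where
  /-- the dimension of the spin space at each site -/
  N : Lattice D → ℕ
  N_pos : ∀ x, 0 < N x
  N_bdd : ∃ M : ℕ, ∀ x, N x ≤ M
  /-- the inclusion of the observables of the finite region `Λ` -/
  embed : ∀ Λ : Finset (Lattice D), SpinMatrix N Λ →⋆ₐ[ℂ] 𝔘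
  embed_injective : ∀ Λ, Function.Injective (embed Λ)
  embed_tensorOne : ∀ (Λ₁ Λ₂ : Finset (Lattice D)) (h : Λ₁ ⊆ Λ₂) (M : SpinMatrix N Λ₁),
    embed Λ₂ (tensorOne h M) = embed Λ₁ M
  dense_local : Dense (⋃ Λ : Finset (Lattice D), Set.range (embed Λ))

/-- The subalgebra `𝔘_Λ` of the observables of the finite region `Λ`. -/
noncomputable def QuasiLocalAlgebra.region {D : ℕ} {𝔘 : Type*} [CStarAlgebra 𝔘]
    (Q : QuasiLocalAlgebra D 𝔘) (Λ : Finset (Lattice D)) : StarSubalgebra ℂ 𝔘 :=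
  (Q.embed Λ).range

/-- `A ∈ 𝔘_loc`. -/
def QuasiLocalAlgebra.IsLocal {D : ℕ} {𝔘 : Type*} [CStarAlgebra 𝔘]
    (Q : QuasiLocalAlgebra D 𝔘) (A : 𝔘) : Prop :=
  ∃ Λ : Finset (Lattice D), A ∈ Q.region Λ

/-- The support of a local observable: the intersection of all regions to which it belongs. -/
def QuasiLocalAlgebra.supp {D : ℕ} {𝔘 : Type*} [CStarAlgebra 𝔘]
    (Q : QuasiLocalAlgebra D 𝔘) (A : 𝔘) : Set (Lattice D) :=
  {x | ∀ Λ : Finset (Lattice D), A ∈ Q.region Λ → x ∈ Λ}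

/-- Quantum lattice C⋆-dynamical system `(𝔘, ι, τ)`: a quasi-local algebra with space translations
`ι` and a strongly continuous, homogeneous time evolution `τ`, both by ⋆-automorphisms. -/
structure LatticeSystem (D : ℕ) (𝔘 : Type*) [CStarAlgebra 𝔘] extends QuasiLocalAlgebra D 𝔘 where
  ι : Lattice D → (𝔘 ≃⋆ₐ[ℂ] 𝔘)
  ι_zero : ∀ A, ι 0 A = A
  ι_add : ∀ x y A, ι (x + y) A = ι x (ι y A)
  ι_region : ∀ (Λ : Finset (Lattice D)) (x : Lattice D) (A : 𝔘),
    A ∈ toQuasiLocalAlgebra.region Λ →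
      ι x A ∈ toQuasiLocalAlgebra.region (Λ.image fun y => y + x)
  τ : ℝ → (𝔘 ≃⋆ₐ[ℂ] 𝔘)
  τ_zero : ∀ A, τ 0 A = A
  τ_add : ∀ s t A, τ (s + t) A = τ s (τ t A)
  τ_continuous : ∀ A, Continuous fun t => τ t A
  τ_ι : ∀ t x A, τ t (ι x A) = ι x (τ t A)

/-- The local Hamiltonian `H_Λ = ∑_{X ⊆ Λ} Φ(X)`. -/
noncomputable def hamiltonian {D : ℕ} {𝔘 : Type*} [CStarAlgebra 𝔘]
    (Φ : Finset (Lattice D) → 𝔘) (Λ : Finset (Lattice D)) : 𝔘 :=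
  ∑ X ∈ Λ.powerset, Φ X

/-- The local time evolution `τ_t^Λ(A) = e^{itH_Λ} A e^{-itH_Λ}`. -/
noncomputable def localEvolution {D : ℕ} {𝔘 : Type*} [CStarAlgebra 𝔘]
    (Φ : Finset (Lattice D) → 𝔘) (Λ : Finset (Lattice D)) (t : ℝ) (A : 𝔘) : 𝔘 :=
  NormedSpace.exp ((Complex.I * t) • hamiltonian Φ Λ) * A *
    NormedSpace.exp ((-(Complex.I * t)) • hamiltonian Φ Λ)

/-- The decay condition on the interaction: for some `λ > 0` and some `F : [0,∞) → (0,∞)` with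
`sup_x ∑_y F(d(x,y)) < ∞` and `sup_{x,y} ∑_z F(d(x,z)) F(d(z,y)) / F(d(x,y)) < ∞`,
the number `‖Φ‖_λ = sup_{x,y} ∑_{X ∋ x,y} ‖Φ(X)‖ / (e^{-λ d(x,y)} F(d(x,y)))` is finite. -/
def ExponentiallyDecaying {D : ℕ} {𝔘 : Type*} [CStarAlgebra 𝔘]
    (Φ : Finset (Lattice D) → 𝔘) : Prop :=
  ∃ (l : ℝ) (F : ℝ → ℝ), 0 < l ∧ (∀ s, 0 ≤ s → 0 < F s) ∧
    (∃ M : ℝ, ∀ x : Lattice D, Summable (fun y : Lattice D => F (latDist x y)) ∧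
      ∑' y : Lattice D, F (latDist x y) ≤ M) ∧
    (∃ M : ℝ, ∀ x y : Lattice D,
      Summable (fun z : Lattice D => F (latDist x z) * F (latDist z y) / F (latDist x y)) ∧
      ∑' z : Lattice D, F (latDist x z) * F (latDist z y) / F (latDist x y) ≤ M) ∧
    (∃ M : ℝ, ∀ x y : Lattice D,
      Summable (fun X : {X : Finset (Lattice D) // x ∈ X ∧ y ∈ X} =>
        ‖Φ X.1‖ / (Real.exp (-l * latDist x y) * F (latDist x y))) ∧
      ∑' X : {X : Finset (Lattice D) // x ∈ X ∧ y ∈ X},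
        ‖Φ X.1‖ / (Real.exp (-l * latDist x y) * F (latDist x y)) ≤ M)

/-- Short-range quantum spin lattice: the time evolution is the infinite-volume limit of the local
time evolutions of an exponentially decaying interaction `Φ`. -/
structure ShortRangeSystem (D : ℕ) (𝔘 : Type*) [CStarAlgebra 𝔘] extends LatticeSystem D 𝔘 where
  Φ : Finset (Lattice D) → 𝔘
  Φ_region : ∀ X, Φ X ∈ toQuasiLocalAlgebra.region X
  Φ_selfAdjoint : ∀ X, IsSelfAdjoint (Φ X)
  Φ_decay : ExponentiallyDecaying Φ
  τ_limit : ∀ (A : 𝔘) (t : ℝ), toQuasiLocalAlgebra.IsLocal A →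
    Tendsto (fun Λ : Finset (Lattice D) => localEvolution Φ Λ t A) atTop (𝓝 (τ t A))

/-- `v > 0` is a Lieb–Robinson velocity of the system: the Lieb–Robinson bound
`‖[τ_t(A), B]‖ ≤ L ‖A‖ ‖B‖ min(|Λ_A|, |Λ_B|) e^{-λ(dist(A,B) - v|t|)}` holds
for all local `A`, `B`, with some constants `L, λ > 0`. -/
def IsLiebRobinsonVelocity {D : ℕ} {𝔘 : Type*} [CStarAlgebra 𝔘] (S : LatticeSystem D 𝔘)
    (v : ℝ) : Prop :=
  0 < v ∧ ∃ (L l : ℝ), 0 < L ∧ 0 < l ∧ ∀ (A B : 𝔘) (t : ℝ), S.IsLocal A → S.IsLocal B →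
    ‖S.τ t A * B - B * S.τ t A‖ ≤
      L * ‖A‖ * ‖B‖ * (min (S.supp A).ncard (S.supp B).ncard : ℕ) *
        Real.exp (-l * (setDist (S.supp A) (S.supp B) - v * |t|))

/-- The space-time translate `A(x,t) = ι_x τ_t A`. -/
def LatticeSystem.translate {D : ℕ} {𝔘 : Type*} [CStarAlgebra 𝔘] (S : LatticeSystem D 𝔘)
    (A : 𝔘) (x : Lattice D) (t : ℝ) : 𝔘 :=
  S.ι x (S.τ t A)

/-- States: positive linear functionals of norm one. -/
def IsState {𝔘 : Type*} [CStarAlgebra 𝔘] (ω : 𝔘 →L[ℂ] ℂ) : Prop :=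
  (∀ A : 𝔘, 0 ≤ (ω (A * star A)).re ∧ (ω (A * star A)).im = 0) ∧ ‖ω‖ = 1

/-- The power-law clustering of three elements, with exponent `p` and constant
`u(v) ‖A‖ ‖B‖ ‖C‖ P(|Λ_B|, |Λ_{AC}|)`, outside the light cones of all velocities `v > vLR`.
Here `Λ_{AC}` is the union of the supports of `A` and `C`. -/
def ThreeElementClustering {D : ℕ} {𝔘 : Type*} [CStarAlgebra 𝔘] (S : LatticeSystem D 𝔘)
    (ω : 𝔘 →L[ℂ] ℂ) (vLR p : ℝ) (P : MvPolynomial (Fin 2) ℝ) (u : ℝ → ℝ) : Prop :=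
  ∀ v : ℝ, vLR < v → ∀ A B C : 𝔘, S.IsLocal A → S.IsLocal B → S.IsLocal C →
    (S.supp B).Nonempty → (S.supp A ∪ S.supp C).Nonempty →
    ∀ (x : Lattice D) (t : ℝ),
      |t| ≤ v⁻¹ * (setDist (S.supp (S.ι x B)) (S.supp A ∪ S.supp C) : ℝ) →
      ‖ω (A * S.translate B x t * C) - ω (A * C) * ω (S.translate B x t)‖ ≤
        u v * ‖A‖ * ‖B‖ * ‖C‖ *
            MvPolynomial.eval ![((S.supp B).ncard : ℝ), ((S.supp A ∪ S.supp C).ncard : ℝ)] P /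
          (1 + (setDist (S.supp (S.ι x B)) (S.supp A ∪ S.supp C) : ℝ)) ^ p

/-- The moment `ω(A_{i₁} ⋯ A_{iₛ})` for `V = {i₁ < ⋯ < iₛ}`. -/
noncomputable def moment {𝔘 : Type*} [CStarAlgebra 𝔘] (ω : 𝔘 →L[ℂ] ℂ) {n : ℕ}
    (A : Fin n → 𝔘) (V : Finset (Fin n)) : ℂ :=
  ω ((V.sort (· ≤ ·)).map A).prod

/-- The classical cumulant `c_n(A_1, …, A_n)`. -/
noncomputable def classicalCumulant {𝔘 : Type*} [CStarAlgebra 𝔘] (ω : 𝔘 →L[ℂ] ℂ) {n : ℕ}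
    (A : Fin n → 𝔘) : ℂ :=
  ∑ π : Finpartition (Finset.univ : Finset (Fin n)),
    (-1) ^ (π.parts.card - 1) * ((π.parts.card - 1).factorial : ℂ) *
      ∏ V ∈ π.parts, moment ω A V

/-- A partition is non-crossing if there are no two distinct blocks `V`, `W` and no
`a < b < c < d` with `a, c ∈ V` and `b, d ∈ W`. -/
def NonCrossing {n : ℕ} {V : Finset (Fin n)} (π : Finpartition V) : Prop :=
  ∀ W₁ ∈ π.parts, ∀ W₂ ∈ π.parts, W₁ ≠ W₂ →
    ∀ a ∈ W₁, ∀ b ∈ W₂, ∀ c ∈ W₁, ∀ d ∈ W₂, ¬ (a < b ∧ b < c ∧ c < d)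

theorem card_lt_of_parts_ne {n : ℕ} {V W : Finset (Fin n)} (π : Finpartition V)
    (hπ : π.parts ≠ {V}) (hW : W ∈ π.parts) : W.card < V.card := by
  apply Finset.card_lt_card
  refine lt_of_le_of_ne (π.le hW) ?_
  rintro rfl
  apply hπ
  refine Finset.eq_singleton_iff_unique_mem.2 ⟨hW, fun U hU => ?_⟩
  by_contra hne
  have hd : Disjoint U W := π.disjoint hU hW hne
  have hle : U ≤ W := π.le hU
  exact π.ne_bot hU (hd.eq_bot_of_le hle)

open Classical in
/-- The free cumulant `κ_{|V|}(A_{i₁}, …, A_{iₛ})` for `V = {i₁ < ⋯ < iₛ}`: the moments-to-cumulants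
formula `ω_V = ∑_{π ∈ NC(V)} ∏_{W ∈ π} κ_W`, solved recursively for the term of the
one-block partition. -/
noncomputable def freeCumulantOn {𝔘 : Type*} [CStarAlgebra 𝔘] (ω : 𝔘 →L[ℂ] ℂ) {n : ℕ}
    (A : Fin n → 𝔘) (V : Finset (Fin n)) : ℂ :=
  moment ω A V -
    ∑ π : {π : Finpartition V // NonCrossing π ∧ π.parts ≠ {V}},
      ∏ W : {W // W ∈ π.1.parts}, freeCumulantOn ω A W.1
termination_by V.card
decreasing_by exact card_lt_of_parts_ne π.1 π.2.2 W.2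

/-- The free cumulant `κ_n(A_1, …, A_n)`. -/
noncomputable def freeCumulant {𝔘 : Type*} [CStarAlgebra 𝔘] (ω : 𝔘 →L[ℂ] ℂ) {n : ℕ}
    (A : Fin n → 𝔘) : ℂ :=
  freeCumulantOn ω A Finset.univ

open Classical in
/-- The free cumulants satisfy the moments-to-cumulants formula. -/
theorem moment_eq_sum_freeCumulantOn {𝔘 : Type*} [CStarAlgebra 𝔘] (ω : 𝔘 →L[ℂ] ℂ) {n : ℕ}
    (A : Fin n → 𝔘) (V : Finset (Fin n)) (hV : V.Nonempty) :
    moment ω A V =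
      ∑ π : {π : Finpartition V // NonCrossing π}, ∏ W ∈ π.1.parts, freeCumulantOn ω A W := by
  have key : ∀ f : Finpartition V → ℂ,
      ∑ π : {π : Finpartition V // NonCrossing π}, f π.1 =
        f (Finpartition.indiscrete hV.ne_empty) +
          ∑ π : {π : Finpartition V // NonCrossing π ∧ π.parts ≠ {V}}, f π.1 := by
    intro f
    have e1 : ∑ π : {π : Finpartition V // NonCrossing π}, f π.1 =
        ∑ π ∈ Finset.univ.filter (fun π : Finpartition V => NonCrossing π), f π :=
      (Finset.sum_subtype _ (by simp) f).symm
    have e2 : ∑ π : {π : Finpartition V // NonCrossing π ∧ π.parts ≠ {V}}, f π.1 =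
        ∑ π ∈ Finset.univ.filter
          (fun π : Finpartition V => NonCrossing π ∧ π.parts ≠ {V}), f π :=
      (Finset.sum_subtype _ (by simp) f).symm
    rw [e1, e2]
    have hins : Finset.univ.filter (fun π : Finpartition V => NonCrossing π) =
        insert (Finpartition.indiscrete hV.ne_empty) (Finset.univ.filter
          (fun π : Finpartition V => NonCrossing π ∧ π.parts ≠ {V})) := by
      ext π
      simp only [Finset.mem_filter, Finset.mem_univ, true_and, Finset.mem_insert]
      constructor
      · intro h
        by_cases hp : π.parts = {V}
        · left
          ext1
          simpa using hp
        · exact Or.inr ⟨h, hp⟩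
      · rintro (rfl | h)
        · intro W₁ h₁ W₂ h₂ hne
          simp only [Finpartition.indiscrete_parts, Finset.mem_singleton] at h₁ h₂
          exact absurd (h₁.trans h₂.symm) hne
        · exact h.1
    rw [hins, Finset.sum_insert]
    simp
  rw [key (fun π => ∏ W ∈ π.parts, freeCumulantOn ω A W)]
  simp only [Finpartition.indiscrete_parts, Finset.prod_singleton]
  conv_rhs => rw [freeCumulantOn]
  have : ∀ π : {π : Finpartition V // NonCrossing π ∧ π.parts ≠ {V}},
      ∏ W : {W // W ∈ π.1.parts}, freeCumulantOn ω A W.1 =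
        ∏ W ∈ π.1.parts, freeCumulantOn ω A W :=
    fun π => Finset.prod_coe_sort π.1.parts (fun W => freeCumulantOn ω A W)
  simp only [this]
  ring

/-- `max_i min_{j ≠ i} dist(A_i(x_i), A_j(x_j))`. -/
noncomputable def LatticeSystem.separation {D : ℕ} {𝔘 : Type*} [CStarAlgebra 𝔘]
    (S : LatticeSystem D 𝔘) {n : ℕ} (A : Fin n → 𝔘) (x : Fin n → Lattice D) : ℕ :=
  ⨆ i : Fin n, ⨅ j : {j : Fin n // j ≠ i},
    setDist (S.supp (S.ι (x i) (A i))) (S.supp (S.ι (x j.1) (A j.1)))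

end QSL

/-! The cumulants are small because one observable, the one with index `i` that realises the maximum
in `z`, is far from all the others, and a cumulant vanishes when one variable factors out of every
moment. The proof is a quantitative version of this.

Dynamics. For a short-range interaction, Grönwall iteration of the commutator growth with the weight
`∑ x ∈ X, ∑ y ∈ Y, e^{-l d(x,y)} F(d(x,y))` gives a finite-volume Lieb–Robinson bound uniform in the
volume, hence a velocity `v₀` of the infinite system
(`ShortRangeSystem.exists_isLiebRobinsonVelocity`). The velocity in the theorem is `6 * v₀`: for `v
> 6 * v₀` and `|t| ≤ z / v`, an evolved observable is, up to an error `e^{-(l/6) z}`, localised in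
the `z/3`-neighbourhood of its support (`exists_local_approximants`). The approximant is an average
of conjugates over a finite group of unitaries outside this neighbourhood. Integral unitary matrices
suffice, since their commutant consists of the scalars.

Clustering. The neighbourhoods are still at distance at least `z/3`, so clustering at time zero
applies to the approximants. They live on `O(z^D)` sites, and the polynomial of degree `r` in these
sizes costs a factor `z^(r D)`; this turns the exponent `p` into `p - r D`. Three elements are
needed because the `i`-th factor stands in the middle of an ordered product. The outcome is `m(W) ≈
m(W \ {i}) m({i})` for all moments `m` with `i ∈ W` (`exists_norm_moment_sub_le`).

Combinatorics. For classical cumulants, group the partitions by what remains after deleting `i`: the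
coefficients make the sum an exact combination of the differences `m(W ∪ {i}) - m(W) m({i})`
(`exists_norm_classicalCumulant_le`). For free cumulants, the non-crossing partitions with block
`{i}` sum to `m({i}) m(V \ {i})`; in the remaining ones `i` lies in a smaller block with at least
two elements, and induction applies (`exists_norm_freeCumulantOn_le_mul`). -/

namespace QSL

/-! ### Matrices on finite regions and the entries of `M ⊗ 1` -/

section SpinMatrices

variable {D : ℕ} {N : Lattice D → ℕ} {Λ₁ Λ₂ Ω Γ : Finset (Lattice D)}

/-- The configuration that equals `b` on `Γ` and `σ` elsewhere. -/
def Config.glue (σ : Config N Ω) (b : Config N Γ) : Config N Ω :=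
  fun x => if h : x.1 ∈ Γ then b ⟨x.1, h⟩ else σ x

theorem Config.restrict_glue (h : Γ ⊆ Ω) (σ : Config N Ω) (b : Config N Γ) :
    Config.restrict h (σ.glue b) = b := by
  funext x
  simp [Config.restrict, Config.glue, x.2]

theorem Config.glue_apply_of_notMem (σ : Config N Ω) (b : Config N Γ) {x : {x // x ∈ Ω}}
    (hx : x.1 ∉ Γ) : σ.glue b x = σ x := by
  simp [Config.glue, hx]

theorem Config.glue_glue (σ : Config N Ω) (a b : Config N Γ) :
    (σ.glue a).glue b = σ.glue b := by
  funext x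
  by_cases hx : x.1 ∈ Γ <;> simp [Config.glue, hx]

theorem Config.glue_restrict (h : Γ ⊆ Ω) (σ η : Config N Ω)
    (hση : ∀ x : {x // x ∈ Ω}, x.1 ∉ Γ → σ x = η x) :
    σ.glue (Config.restrict h η) = η := by
  funext x
  by_cases hx : x.1 ∈ Γ
  · simp [Config.glue, Config.restrict, hx]
  · simp [Config.glue, hx, hση x hx]

/-- The row `σ` of `X ⊗ 1` is supported on the configurations that agree with `σ` off `Γ`, and
gluing parametrises these by the configurations of `Γ`. -/
theorem sum_tensorOne_mul (h : Γ ⊆ Ω) (X : SpinMatrix N Γ) (σ : Config N Ω)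
    (f : Config N Ω → ℂ) :
    ∑ ζ, tensorOne h X σ ζ * f ζ = ∑ b, X (Config.restrict h σ) b * f (σ.glue b) := by
  symm
  refine Finset.sum_of_injOn (fun b => σ.glue b) ?_ (by simp) ?_ ?_
  · intro a _ b _ hab
    have := congrArg (Config.restrict h) hab
    simpa [Config.restrict_glue] using this
  · intro ζ _ hζ
    rw [tensorOne, if_neg, zero_mul]
    intro hoff
    exact hζ ⟨Config.restrict h ζ, by simp, Config.glue_restrict h σ ζ hoff⟩
  · intro b _
    rw [tensorOne, if_pos, Config.restrict_glue]
    intro x hx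
    rw [Config.glue_apply_of_notMem _ _ hx]

theorem sum_mul_tensorOne (h : Γ ⊆ Ω) (X : SpinMatrix N Γ) (η : Config N Ω)
    (f : Config N Ω → ℂ) :
    ∑ ζ, f ζ * tensorOne h X ζ η = ∑ b, f (η.glue b) * X b (Config.restrict h η) := by
  symm
  refine Finset.sum_of_injOn (fun b => η.glue b) ?_ (by simp) ?_ ?_
  · intro a _ b _ hab
    have := congrArg (Config.restrict h) hab
    simpa [Config.restrict_glue] using this
  · intro ζ _ hζ
    rw [tensorOne, if_neg, mul_zero]
    intro hoff
    exact hζ ⟨Config.restrict h ζ, by simp,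
      Config.glue_restrict h η ζ fun x hx => (hoff x hx).symm⟩
  · intro b _
    rw [tensorOne, if_pos, Config.restrict_glue]
    intro x hx
    rw [Config.glue_apply_of_notMem _ _ hx]

theorem tensorOne_mul_apply (h : Γ ⊆ Ω) (X : SpinMatrix N Γ) (M : SpinMatrix N Ω)
    (σ η : Config N Ω) :
    (tensorOne h X * M) σ η = ∑ b, X (Config.restrict h σ) b * M (σ.glue b) η :=
  sum_tensorOne_mul h X σ fun ζ => M ζ η

theorem mul_tensorOne_apply (h : Γ ⊆ Ω) (X : SpinMatrix N Γ) (M : SpinMatrix N Ω)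
    (σ η : Config N Ω) :
    (M * tensorOne h X) σ η = ∑ b, M σ (η.glue b) * X b (Config.restrict h η) :=
  sum_mul_tensorOne h X η fun ζ => M σ ζ

/-- Observables of disjoint regions multiply like elementary tensors. -/
theorem tensorOne_mul_tensorOne_apply (h₁ : Λ₁ ⊆ Ω) (h₂ : Λ₂ ⊆ Ω) (hd : Disjoint Λ₁ Λ₂)
    (M₁ : SpinMatrix N Λ₁) (M₂ : SpinMatrix N Λ₂) (σ η : Config N Ω) :
    (tensorOne h₁ M₁ * tensorOne h₂ M₂) σ η =
      if ∀ x : {x // x ∈ Ω}, x.1 ∉ Λ₁ → x.1 ∉ Λ₂ → σ x = η x then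
        M₁ (Config.restrict h₁ σ) (Config.restrict h₁ η) *
          M₂ (Config.restrict h₂ σ) (Config.restrict h₂ η) else 0 := by
  -- Only one intermediate configuration contributes: it must agree with `η` off `Λ₂`, in particular
  -- on `Λ₁`, and with `σ` off `Λ₁`.
  rw [tensorOne_mul_apply, Finset.sum_eq_single (Config.restrict h₁ η)]
  · have hres : Config.restrict h₂ (σ.glue (Config.restrict h₁ η)) = Config.restrict h₂ σ := by
      funext x
      exact Config.glue_apply_of_notMem _ _ (x := ⟨x.1, h₂ x.2⟩)
        (Finset.disjoint_right.1 hd x.2)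
    have hiff : (∀ x : {x // x ∈ Ω}, x.1 ∉ Λ₂ → σ.glue (Config.restrict h₁ η) x = η x) ↔
        ∀ x : {x // x ∈ Ω}, x.1 ∉ Λ₁ → x.1 ∉ Λ₂ → σ x = η x := by
      constructor
      · intro h x hx₁ hx₂
        rw [← h x hx₂, Config.glue_apply_of_notMem _ _ hx₁]
      · intro h x hx₂
        by_cases hx₁ : x.1 ∈ Λ₁
        · simp [Config.glue, Config.restrict, hx₁]
        · rw [Config.glue_apply_of_notMem _ _ hx₁, h x hx₁ hx₂]
    simp only [tensorOne, hiff, hres, mul_ite, mul_zero]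
  · intro b _ hb
    rw [tensorOne, if_neg, mul_zero]
    intro h
    apply hb
    funext x
    have := h ⟨x.1, h₁ x.2⟩ (Finset.disjoint_left.1 hd x.2)
    rw [Config.glue, dif_pos x.2] at this
    exact this
  · simp

theorem tensorOne_commute (h₁ : Λ₁ ⊆ Ω) (h₂ : Λ₂ ⊆ Ω) (hd : Disjoint Λ₁ Λ₂)
    (M₁ : SpinMatrix N Λ₁) (M₂ : SpinMatrix N Λ₂) :
    Commute (tensorOne h₁ M₁) (tensorOne h₂ M₂) := by
  ext σ η
  rw [tensorOne_mul_tensorOne_apply h₁ h₂ hd, tensorOne_mul_tensorOne_apply h₂ h₁ hd.symm]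
  have : (∀ x : {x // x ∈ Ω}, x.1 ∉ Λ₁ → x.1 ∉ Λ₂ → σ x = η x) ↔
      ∀ x : {x // x ∈ Ω}, x.1 ∉ Λ₂ → x.1 ∉ Λ₁ → σ x = η x :=
    ⟨fun h x a b => h x b a, fun h x a b => h x b a⟩
  simp only [this, mul_comm]

end SpinMatrices

/-! ### The finite group of integral unitary matrices -/

section IntegralUnitaries

variable {c : Type*} [Fintype c] [DecidableEq c]

/-- The reflection in the hyperplane orthogonal to the basis vector `a`. -/
def signFlip (a : c) : unitary (Matrix c c ℤ) :=
  ⟨Matrix.diagonal fun i => if i = a then -1 else 1, by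
    rw [Unitary.mem_iff]
    constructor <;>
    · rw [Matrix.star_eq_conjTranspose, Matrix.diagonal_conjTranspose, Matrix.diagonal_mul_diagonal,
        ← Matrix.diagonal_one]
      congr 1
      funext i
      by_cases h : i = a <;> simp [h]⟩

/-- The permutation matrix of the transposition of `a` and `b`. -/
def swapMatrix (a b : c) : unitary (Matrix c c ℤ) :=
  ⟨Matrix.of fun i j => if Equiv.swap a b i = j then 1 else 0, by
    rw [Unitary.mem_iff]
    constructor
    · ext i j
      simp only [Matrix.mul_apply, Matrix.star_apply, Matrix.of_apply, star_trivial]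
      rw [Equiv.sum_comp (Equiv.swap a b)
        fun k => (if k = i then (1 : ℤ) else 0) * if k = j then 1 else 0]
      simp [Matrix.one_apply, eq_comm]
    · ext i j
      simp [Matrix.mul_apply, Matrix.star_apply, Matrix.one_apply, eq_comm]⟩

theorem entry_mem_Icc_of_mem_unitary {U : Matrix c c ℤ} (hU : U ∈ unitary (Matrix c c ℤ)) (i j : c) :
    U i j ∈ Set.Icc (-1 : ℤ) 1 := by
  have h : (U * star U) i i = (1 : Matrix c c ℤ) i i := by
    rw [Unitary.mul_star_self_of_mem hU]
  simp only [Matrix.mul_apply, Matrix.star_apply, star_trivial, Matrix.one_apply_eq] at h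
  have h1 : U i j * U i j ≤ 1 := by
    rw [← h]
    exact Finset.single_le_sum (f := fun j => U i j * U i j)
      (fun k _ => mul_self_nonneg _) (Finset.mem_univ j)
  constructor <;> nlinarith

/-- The rows are integer vectors of norm one, so the entries lie in `{-1, 0, 1}`. Finiteness allows
averages over this group to be plain sums instead of Haar integrals. -/
noncomputable instance : Fintype (unitary (Matrix c c ℤ)) := by
  refine @Fintype.ofFinite _ ?_
  have : Set.Finite {f : c → c → ℤ | ∀ i, f i ∈ {g : c → ℤ | ∀ j, g j ∈ Set.Icc (-1 : ℤ) 1}} :=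
    Set.Finite.pi' fun _ => Set.Finite.pi' fun _ => Set.finite_Icc _ _
  exact Set.Finite.subset this fun U hU i j => entry_mem_Icc_of_mem_unitary hU i j

end IntegralUnitaries

/-! ### The commutant of the integral unitaries of a region -/

section Commutant

variable {D : ℕ} {N : Lattice D → ℕ} {Ω Γ : Finset (Lattice D)}

/-- A matrix that commutes with the integral unitaries of `Γ` is an observable of the complement. -/
theorem exists_tensorOne_of_commute (hN : ∀ x, 0 < N x) (h : Γ ⊆ Ω) (M : SpinMatrix N Ω)
    (hM : ∀ U : unitary (Matrix (Config N Γ) (Config N Γ) ℤ),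
      Commute (tensorOne h (U.1.map (Int.cast : ℤ → ℂ))) M) :
    ∃ M' : SpinMatrix N (Ω \ Γ), tensorOne Finset.sdiff_subset M' = M := by
  have hentry : ∀ (U : unitary (Matrix (Config N Γ) (Config N Γ) ℤ)) (σ η : Config N Ω),
      ∑ b, (U.1 (Config.restrict h σ) b : ℂ) * M (σ.glue b) η =
        ∑ b, M σ (η.glue b) * (U.1 b (Config.restrict h η) : ℂ) := by
    intro U σ η
    have := congrFun (congrFun (hM U) σ) η
    rw [tensorOne_mul_apply, mul_tensorOne_apply] at this
    exact this
  have hoff : ∀ σ η : Config N Ω, Config.restrict h σ ≠ Config.restrict h η → M σ η = 0 := by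
    intro σ η hne
    -- The reflection multiplies the row index by `-1` and leaves the column index alone, so the
    -- entry equals its own negative.
    have := hentry (signFlip (Config.restrict h σ)) σ η
    simp only [signFlip, Matrix.diagonal_apply] at this
    rw [Finset.sum_eq_single (Config.restrict h σ) (by intro b _ hb; simp [hb.symm]) (by simp),
      Finset.sum_eq_single (Config.restrict h η) (by intro b _ hb; simp [hb]) (by simp),
      Config.glue_restrict h σ σ (fun _ _ => rfl),
      Config.glue_restrict h η η (fun _ _ => rfl)] at this
    simp only [if_true, hne.symm, if_false] at this
    push_cast at this
    linear_combination (-1 / 2 : ℂ) * this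
  have hglue : ∀ (σ η : Config N Ω) (a b : Config N Γ), Config.restrict h σ = a →
      M (σ.glue b) (η.glue b) = M σ (η.glue a) := by
    intro σ η a b ha
    -- Commuting with transpositions makes the diagonal blocks over `Γ` independent of the
    -- configuration on `Γ`.
    have := hentry (swapMatrix a b) σ (η.glue b)
    simp only [swapMatrix, Matrix.of_apply, Config.restrict_glue, Config.glue_glue, ha] at this
    rw [Finset.sum_eq_single b (by intro c _ hc; simp [hc.symm]) (by simp),
      Finset.sum_eq_single a
        (by intro c _ hc; rw [if_neg]; · simp
            rw [← Equiv.eq_symm_apply]; simpa using hc) (by simp)] at this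
    simpa using this
  -- By this independence the entries of the reduced matrix may be read off at any reference
  -- configuration of `Γ`; `b₀` is one, available since each `N x` is positive.
  let b₀ : Config N Γ := fun x => ⟨0, hN x.1⟩
  let ext : Config N (Ω \ Γ) → Config N Ω := fun α x =>
    if hx : x.1 ∈ Γ then b₀ ⟨x.1, hx⟩ else α ⟨x.1, Finset.mem_sdiff.2 ⟨x.2, hx⟩⟩
  have hext : ∀ σ : Config N Ω, ext (Config.restrict Finset.sdiff_subset σ) = σ.glue b₀ := by
    intro σ
    funext x
    by_cases hx : x.1 ∈ Γ <;> simp [ext, Config.glue, Config.restrict, hx]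
  refine ⟨fun α β => M (ext α) (ext β), ?_⟩
  ext σ η
  have hiff : (∀ x : {x // x ∈ Ω}, x.1 ∉ Ω \ Γ → σ x = η x) ↔
      Config.restrict h σ = Config.restrict h η := by
    constructor
    · intro hx
      funext x
      exact hx ⟨x.1, h x.2⟩ (by simp [x.2])
    · intro hr x hx
      have hxΓ : x.1 ∈ Γ := by
        by_contra hc
        exact hx (Finset.mem_sdiff.2 ⟨x.2, hc⟩)
      exact congrFun hr ⟨x.1, hxΓ⟩
  simp only [tensorOne, hiff, hext]
  split_ifs with hr
  · rw [hglue σ η _ b₀ rfl, hr, Config.glue_restrict h η η (fun _ _ => rfl)]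
  · exact (hoff σ η hr).symm

end Commutant

end QSL
namespace QSL

/-! ### The lattice distance and neighbourhoods of finite regions -/

section LatticeDistance

variable {D : ℕ}

theorem latDist_self (x : Lattice D) : latDist x x = 0 := by simp [latDist]

theorem latDist_comm (x y : Lattice D) : latDist x y = latDist y x := by
  unfold latDist
  exact Finset.sum_congr rfl fun i _ => by rw [← Int.natAbs_neg, neg_sub]

theorem latDist_triangle (x y z : Lattice D) : latDist x z ≤ latDist x y + latDist y z := by
  unfold latDist
  rw [← Finset.sum_add_distrib]
  refine Finset.sum_le_sum fun i _ => ?_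
  have h : x i - z i = (x i - y i) + (y i - z i) := by ring
  rw [h]
  exact Int.natAbs_add_le _ _

theorem setDist_le {X Y : Set (Lattice D)} {x y : Lattice D} (hx : x ∈ X) (hy : y ∈ Y) :
    setDist X Y ≤ latDist x y :=
  Nat.sInf_le ⟨x, hx, y, hy, rfl⟩

/-- Nonemptiness matters: the infimum of the empty set of natural numbers is `0`. -/
theorem le_setDist {X Y : Set (Lattice D)} (hX : X.Nonempty) (hY : Y.Nonempty) {k : ℕ}
    (h : ∀ x ∈ X, ∀ y ∈ Y, k ≤ latDist x y) : k ≤ setDist X Y := by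
  obtain ⟨x, hx⟩ := hX
  obtain ⟨y, hy⟩ := hY
  refine le_csInf ⟨_, x, hx, y, hy, rfl⟩ ?_
  rintro _ ⟨x, hx, y, hy, rfl⟩
  exact h x hx y hy

theorem sub_mem_Icc_of_latDist_le {x y : Lattice D} {k : ℕ} (h : latDist x y ≤ k) (i : Fin D) :
    y i ∈ Finset.Icc (x i - k) (x i + k) := by
  have h1 : (x i - y i).natAbs ≤ k :=
    (Finset.single_le_sum (f := fun i => (x i - y i).natAbs) (fun _ _ => Nat.zero_le _)
      (Finset.mem_univ i)).trans h
  rw [Finset.mem_Icc]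
  omega

/-- The points at distance at most `k` from `X`. -/
noncomputable def thickening (k : ℕ) (X : Finset (Lattice D)) : Finset (Lattice D) :=
  X.biUnion fun x =>
    (Fintype.piFinset fun i => Finset.Icc (x i - k) (x i + k)).filter fun y => latDist x y ≤ k

theorem mem_thickening {k : ℕ} {X : Finset (Lattice D)} {y : Lattice D} :
    y ∈ thickening k X ↔ ∃ x ∈ X, latDist x y ≤ k := by
  simp only [thickening, Finset.mem_biUnion, Finset.mem_filter, Fintype.mem_piFinset]
  constructor
  · rintro ⟨x, hx, -, h⟩
    exact ⟨x, hx, h⟩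
  · rintro ⟨x, hx, h⟩
    exact ⟨x, hx, sub_mem_Icc_of_latDist_le h, h⟩

theorem card_thickening_le (k : ℕ) (X : Finset (Lattice D)) :
    (thickening k X).card ≤ X.card * (2 * k + 1) ^ D := by
  refine Finset.card_biUnion_le_card_mul _ _ _ fun x _ => ?_
  refine (Finset.card_filter_le _ _).trans ?_
  rw [Fintype.card_piFinset]
  refine (Finset.prod_le_pow_card _ _ (2 * k + 1) fun i _ => ?_).trans (by simp)
  rw [Int.card_Icc]
  omega

end LatticeDistance

/-! ### Averaging, supports and local approximation -/

namespace QuasiLocalAlgebra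

variable {D : ℕ} {𝔘 : Type*} [CStarAlgebra 𝔘] (Q : QuasiLocalAlgebra D 𝔘)
  {Λ₁ Λ₂ Ω Γ : Finset (Lattice D)} {A B : 𝔘}

theorem nontrivial (Q : QuasiLocalAlgebra D 𝔘) : Nontrivial 𝔘 := by
  have : Nonempty (Config Q.N ∅) := ⟨fun x => absurd x.2 (Finset.notMem_empty _)⟩
  exact (Q.embed_injective ∅).nontrivial

theorem mem_region : A ∈ Q.region Ω ↔ ∃ M, Q.embed Ω M = A := Iff.rfl

theorem region_mono (h : Λ₁ ⊆ Λ₂) : Q.region Λ₁ ≤ Q.region Λ₂ := by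
  rintro _ ⟨M, rfl⟩
  exact ⟨tensorOne h M, Q.embed_tensorOne Λ₁ Λ₂ h M⟩

theorem commute_of_disjoint (hd : Disjoint Λ₁ Λ₂) (hA : A ∈ Q.region Λ₁)
    (hB : B ∈ Q.region Λ₂) : Commute A B := by
  obtain ⟨M₁, rfl⟩ := Q.mem_region.1 hA
  obtain ⟨M₂, rfl⟩ := Q.mem_region.1 hB
  rw [← Q.embed_tensorOne Λ₁ (Λ₁ ∪ Λ₂) Finset.subset_union_left,
    ← Q.embed_tensorOne Λ₂ (Λ₁ ∪ Λ₂) Finset.subset_union_right]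
  exact (tensorOne_commute _ _ hd M₁ M₂).map (Q.embed (Λ₁ ∪ Λ₂))

/-- The integral unitaries of the region `Γ`, as elements of the quasi-local algebra. -/
noncomputable def localUnitary (Γ : Finset (Lattice D)) :
    unitary (Matrix (Config Q.N Γ) (Config Q.N Γ) ℤ) →* 𝔘 where
  toFun U := Q.embed Γ (U.1.map (Int.cast : ℤ → ℂ))
  map_one' := by
    rw [OneMemClass.coe_one, Matrix.map_one _ Int.cast_zero Int.cast_one, map_one]
  map_mul' U V := by
    rw [← map_mul]
    congr 1
    exact Matrix.map_mul (f := Int.castRingHom ℂ)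

theorem localUnitary_mem_region (U) : Q.localUnitary Γ U ∈ Q.region Γ := ⟨_, rfl⟩

theorem star_localUnitary (U) : star (Q.localUnitary Γ U) = Q.localUnitary Γ (star U) := by
  change star (Q.embed Γ _) = Q.embed Γ _
  rw [← map_star]
  congr 1
  ext i j
  simp [Matrix.star_apply]

theorem localUnitary_mem_unitary (U) : Q.localUnitary Γ U ∈ unitary 𝔘 := by
  rw [Unitary.mem_iff, star_localUnitary, ← map_mul, ← map_mul]
  simp

/-- The mean of the conjugates of `A` by the integral unitaries of `Γ`. -/
noncomputable def average (Γ : Finset (Lattice D)) (A : 𝔘) : 𝔘 :=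
  (Fintype.card (unitary (Matrix (Config Q.N Γ) (Config Q.N Γ) ℤ)) : ℂ)⁻¹ •
    ∑ U : unitary (Matrix (Config Q.N Γ) (Config Q.N Γ) ℤ),
      Q.localUnitary Γ U * A * Q.localUnitary Γ (star U)

theorem norm_mean_le {ι : Type*} [Fintype ι] [Nonempty ι] {f : ι → 𝔘} {c : ℝ}
    (h : ∀ i, ‖f i‖ ≤ c) : ‖(Fintype.card ι : ℂ)⁻¹ • ∑ i, f i‖ ≤ c := by
  have hpos : (0 : ℝ) < Fintype.card ι := by exact_mod_cast Fintype.card_pos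
  rw [norm_smul, norm_inv, Complex.norm_natCast, inv_mul_le_iff₀ hpos]
  refine (norm_sum_le_of_le _ fun i _ => h i).trans ?_
  simp

theorem norm_average_le (A : 𝔘) : ‖Q.average Γ A‖ ≤ ‖A‖ := by
  refine norm_mean_le fun U => ?_
  rw [CStarRing.norm_mul_mem_unitary _ (Q.localUnitary_mem_unitary _),
    CStarRing.norm_mem_unitary_mul _ (Q.localUnitary_mem_unitary _)]

theorem average_sub (A B : 𝔘) : Q.average Γ (A - B) = Q.average Γ A - Q.average Γ B := by
  simp only [average, mul_sub, sub_mul, Finset.sum_sub_distrib, smul_sub]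

/-- Each conjugate differs from `A` by a commutator times a unitary, and a mean of such differences
obeys the common bound. -/
theorem norm_average_sub_le {c : ℝ}
    (h : ∀ U, ‖A * Q.localUnitary Γ U - Q.localUnitary Γ U * A‖ ≤ c) :
    ‖Q.average Γ A - A‖ ≤ c := by
  have hA : Q.average Γ A - A = (Fintype.card
      (unitary (Matrix (Config Q.N Γ) (Config Q.N Γ) ℤ)) : ℂ)⁻¹ •
      ∑ U : unitary (Matrix (Config Q.N Γ) (Config Q.N Γ) ℤ),
        (Q.localUnitary Γ U * A - A * Q.localUnitary Γ U) * Q.localUnitary Γ (star U) := by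
    have h1 : ∀ U : unitary (Matrix (Config Q.N Γ) (Config Q.N Γ) ℤ),
        (Q.localUnitary Γ U * A - A * Q.localUnitary Γ U) * Q.localUnitary Γ (star U) =
          Q.localUnitary Γ U * A * Q.localUnitary Γ (star U) - A := by
      intro U
      rw [sub_mul, mul_assoc A, ← map_mul]
      simp
    simp only [h1, Finset.sum_sub_distrib, smul_sub, average]
    congr 1
    rw [Finset.sum_const, Finset.card_univ, ← Nat.cast_smul_eq_nsmul ℂ, smul_smul,
      inv_mul_cancel₀ (by exact_mod_cast Fintype.card_ne_zero), one_smul]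
  rw [hA]
  refine norm_mean_le fun U => ?_
  rw [CStarRing.norm_mul_mem_unitary _ (Q.localUnitary_mem_unitary _), norm_sub_rev]
  exact h U

theorem commute_localUnitary_average (U) : Commute (Q.localUnitary Γ U) (Q.average Γ A) := by
  have h : Q.localUnitary Γ U * Q.average Γ A * Q.localUnitary Γ (star U) = Q.average Γ A := by
    rw [average, mul_smul_comm, smul_mul_assoc, Finset.mul_sum, Finset.sum_mul]
    congr 1
    -- Left multiplication by `U` permutes the group, which makes the average invariant under
    -- conjugation by `U`.
    refine Fintype.sum_equiv (Equiv.mulLeft U) _ _ fun V => ?_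
    simp only [Equiv.coe_mulLeft, star_mul, map_mul, mul_assoc]
  have hU : Q.localUnitary Γ (star U) * Q.localUnitary Γ U = 1 := by
    rw [← map_mul]
    simp
  calc Q.localUnitary Γ U * Q.average Γ A
      = Q.localUnitary Γ U * Q.average Γ A * (Q.localUnitary Γ (star U) * Q.localUnitary Γ U) := by
        rw [hU, mul_one]
    _ = Q.average Γ A * Q.localUnitary Γ U := by rw [← mul_assoc, h]

/-- The average stays in the region `Ω` and commutes with the integral unitaries of `Γ`; the
commutant lemma then removes `Γ`. Injectivity of the embedding transfers this from the algebra to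
matrices. -/
theorem average_mem_region (h : Γ ⊆ Ω) (hA : A ∈ Q.region Ω) :
    Q.average Γ A ∈ Q.region (Ω \ Γ) := by
  have hmem : Q.average Γ A ∈ Q.region Ω := by
    refine SMulMemClass.smul_mem _ (sum_mem fun U _ => mul_mem (mul_mem ?_ hA) ?_) <;>
    exact Q.region_mono h (Q.localUnitary_mem_region _)
  obtain ⟨M, hM⟩ := Q.mem_region.1 hmem
  obtain ⟨M', hM'⟩ := exists_tensorOne_of_commute Q.N_pos h M fun U => by
    apply Q.embed_injective Ω
    rw [map_mul, map_mul, Q.embed_tensorOne, hM]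
    exact Q.commute_localUnitary_average U
  exact ⟨M', by rw [← hM, ← hM']; exact (Q.embed_tensorOne _ _ Finset.sdiff_subset M').symm⟩

/-- Averaging over `Λ₁ \ Λ₂` maps `A` into the region `Λ₁ ∩ Λ₂`, but it also fixes `A`, which
commutes with these unitaries as an observable of `Λ₂`. -/
theorem mem_region_inter (h₁ : A ∈ Q.region Λ₁) (h₂ : A ∈ Q.region Λ₂) :
    A ∈ Q.region (Λ₁ ∩ Λ₂) := by
  have h := Q.average_mem_region (Finset.sdiff_subset : Λ₁ \ Λ₂ ⊆ Λ₁) h₁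
  rw [Finset.sdiff_sdiff_self_left] at h
  have heq : ‖Q.average (Λ₁ \ Λ₂) A - A‖ ≤ 0 := by
    refine Q.norm_average_sub_le fun U => ?_
    rw [(Q.commute_of_disjoint Finset.disjoint_sdiff h₂ (Q.localUnitary_mem_region U)).eq, sub_self,
      norm_zero]
  rwa [sub_eq_zero.1 (norm_le_zero_iff.1 heq)] at h

theorem supp_subset (hA : A ∈ Q.region Ω) : Q.supp A ⊆ Ω := fun _ hx => hx Ω hA

/-- A local observable belongs to the region that is its support. -/
theorem IsLocal.exists_region_eq_supp (hA : Q.IsLocal A) :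
    ∃ X : Finset (Lattice D), (X : Set (Lattice D)) = Q.supp A ∧ A ∈ Q.region X := by
  classical
  -- A region of minimal cardinality is contained in every other region of `A`, as its intersection
  -- with one of them is again a region of `A`.
  have hex : ∃ k, ∃ X : Finset (Lattice D), A ∈ Q.region X ∧ X.card = k :=
    ⟨_, hA.choose, hA.choose_spec, rfl⟩
  obtain ⟨X, hX, hcard⟩ := Nat.find_spec hex
  refine ⟨X, Set.Subset.antisymm (fun x hx Λ hΛ => ?_) (Q.supp_subset hX), hX⟩
  have h1 : X.card ≤ (X ∩ Λ).card := by
    rw [hcard]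
    exact Nat.find_min' hex ⟨_, Q.mem_region_inter hX hΛ, rfl⟩
  have h2 := Finset.eq_of_subset_of_card_le Finset.inter_subset_left h1
  exact (Finset.mem_inter.1 (h2.symm ▸ hx : x ∈ X ∩ Λ)).2

theorem IsLocal.finite_supp (hA : Q.IsLocal A) : (Q.supp A).Finite := by
  obtain ⟨X, hX, -⟩ := hA.exists_region_eq_supp
  rw [← hX]
  exact X.finite_toSet

theorem ncard_supp_le (hA : A ∈ Q.region Ω) : (Q.supp A).ncard ≤ Ω.card := by
  rw [← Set.ncard_coe_finset]
  exact Set.ncard_le_ncard (Q.supp_subset hA) Ω.finite_toSet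

/-- An observable with empty support is a scalar. -/
theorem exists_algebraMap_of_supp_eq_empty (hA : Q.IsLocal A) (h : Q.supp A = ∅) :
    ∃ c : ℂ, A = algebraMap ℂ 𝔘 c := by
  obtain ⟨X, hX, hAX⟩ := hA.exists_region_eq_supp
  rw [h, Finset.coe_eq_empty] at hX
  subst hX
  obtain ⟨M, rfl⟩ := Q.mem_region.1 hAX
  have : Unique (Config Q.N ∅) :=
    { default := fun x => absurd x.2 (Finset.notMem_empty _)
      uniq := fun σ => funext fun x => absurd x.2 (Finset.notMem_empty _) }
  refine ⟨M default default, ?_⟩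
  rw [← AlgHomClass.commutes (Q.embed ∅)]
  congr 1
  ext i j
  rw [Subsingleton.elim i default, Subsingleton.elim j default]
  simp [Matrix.algebraMap_matrix_apply]

/-- An element that almost commutes with the observables outside of `X` is close to an observable
of `X`. -/
theorem exists_mem_region_norm_sub_le {X : Finset (Lattice D)} {c ε : ℝ} (hε : 0 < ε)
    (h : ∀ U, Q.IsLocal U → ‖U‖ ≤ 1 → Disjoint (Q.supp U) X → ‖A * U - U * A‖ ≤ c) :
    ∃ B ∈ Q.region X, ‖B - A‖ ≤ c + ε := by
  have := Q.nontrivial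
  obtain ⟨B, hB, hAB⟩ := Metric.dense_iff.1 Q.dense_local A ε hε
  obtain ⟨Λ, hΛ⟩ := Set.mem_iUnion.1 hAB
  rw [Metric.mem_ball, dist_eq_norm] at hB
  -- A local element `ε`-close to `A` is averaged over the part of its region outside `X`. The
  -- average is a contraction, so it keeps the error `ε`, and it moves `A` itself by at most `c`.
  refine ⟨Q.average (Λ \ X) B, ?_, ?_⟩
  · have h1 := Q.average_mem_region (Finset.sdiff_subset : Λ \ X ⊆ Λ) hΛ
    rw [Finset.sdiff_sdiff_self_left] at h1
    exact Q.region_mono Finset.inter_subset_right h1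
  · have h1 : ‖Q.average (Λ \ X) A - A‖ ≤ c := by
      refine Q.norm_average_sub_le fun U => h _ ⟨_, Q.localUnitary_mem_region U⟩
        (CStarRing.norm_of_mem_unitary (Q.localUnitary_mem_unitary U)).le ?_
      refine Set.disjoint_of_subset_left (Q.supp_subset (Q.localUnitary_mem_region U)) ?_
      exact_mod_cast Finset.sdiff_disjoint
    have h2 : Q.average (Λ \ X) B - A =
        (Q.average (Λ \ X) A - A) + Q.average (Λ \ X) (B - A) := by
      rw [average_sub]
      abel
    rw [h2]
    exact norm_add_le_of_le h1 ((Q.norm_average_le _).trans hB.le)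

end QuasiLocalAlgebra

/-! ### Norms and supports under translation and evolution -/

namespace LatticeSystem

variable {D : ℕ} {𝔘 : Type*} [CStarAlgebra 𝔘] (S : LatticeSystem D 𝔘) {A : 𝔘}

theorem ι_neg_ι (x : Lattice D) (A : 𝔘) : S.ι (-x) (S.ι x A) = A := by
  rw [← S.ι_add, neg_add_cancel, S.ι_zero]

theorem norm_ι (x : Lattice D) (A : 𝔘) : ‖S.ι x A‖ = ‖A‖ := StarAlgEquiv.norm_map (S.ι x) A

theorem norm_τ (t : ℝ) (A : 𝔘) : ‖S.τ t A‖ = ‖A‖ := StarAlgEquiv.norm_map (S.τ t) A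

theorem isLocal_ι (hA : S.IsLocal A) (x : Lattice D) : S.IsLocal (S.ι x A) := by
  obtain ⟨Λ, hΛ⟩ := hA
  exact ⟨_, S.ι_region Λ x A hΛ⟩

theorem supp_ι_subset (hA : S.IsLocal A) (x : Lattice D) :
    S.supp (S.ι x A) ⊆ (· + x) '' S.supp A := by
  obtain ⟨X, hX, hAX⟩ := hA.exists_region_eq_supp
  refine (S.supp_subset (S.ι_region X x A hAX)).trans ?_
  rw [← hX, Finset.coe_image]

theorem supp_ι (hA : S.IsLocal A) (x : Lattice D) : S.supp (S.ι x A) = (· + x) '' S.supp A := by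
  refine (S.supp_ι_subset hA x).antisymm ?_
  rintro _ ⟨y, hy, rfl⟩
  have h := S.supp_ι_subset (S.isLocal_ι hA x) (-x)
  rw [ι_neg_ι] at h
  obtain ⟨z, hz, rfl⟩ := h hy
  simpa using hz

theorem ncard_supp_ι (hA : S.IsLocal A) (x : Lattice D) :
    (S.supp (S.ι x A)).ncard = (S.supp A).ncard := by
  rw [S.supp_ι hA, Set.ncard_image_of_injective _ (add_left_injective x)]

end LatticeSystem

end QSL
namespace QSL

/-! ### One-parameter groups of inner automorphisms -/

section Conjugation

variable {𝔘 : Type*} [CStarAlgebra 𝔘]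

/-- The inner automorphism `X ↦ e^{tK} X e^{-tK}`. -/
noncomputable def expConj (K : 𝔘) (t : ℝ) (X : 𝔘) : 𝔘 :=
  NormedSpace.exp (t • K) * X * NormedSpace.exp ((-t) • K)

theorem exp_neg_smul_mul_exp_smul (K : 𝔘) (t : ℝ) :
    NormedSpace.exp ((-t) • K) * NormedSpace.exp (t • K) = 1 := by
  let _ := NormedAlgebra.restrictScalars ℚ ℂ 𝔘
  rw [← NormedSpace.exp_add_of_commute, ← add_smul, neg_add_cancel, zero_smul,
    NormedSpace.exp_zero]
  exact ((Commute.refl K).smul_left _).smul_right _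

theorem expConj_zero (K X : 𝔘) : expConj K 0 X = X := by
  simp [expConj, NormedSpace.exp_zero]

theorem expConj_mul (K : 𝔘) (t : ℝ) (X Y : 𝔘) :
    expConj K t (X * Y) = expConj K t X * expConj K t Y := by
  have h : ∀ a b c d e f : 𝔘, c * d = 1 → a * (b * e) * f = a * b * c * (d * e * f) := by
    intro a b c d e f h
    calc a * (b * e) * f = a * b * 1 * (e * f) := by noncomm_ring
      _ = a * b * c * (d * e * f) := by rw [← h]; noncomm_ring
  exact h _ _ _ _ _ _ (exp_neg_smul_mul_exp_smul K t)

theorem expConj_sub (K : 𝔘) (t : ℝ) (X Y : 𝔘) :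
    expConj K t (X - Y) = expConj K t X - expConj K t Y := by
  simp only [expConj, mul_sub, sub_mul]

theorem expConj_smul (K : 𝔘) (t : ℝ) (c : ℂ) (X : 𝔘) :
    expConj K t (c • X) = c • expConj K t X := by
  simp only [expConj, mul_smul_comm, smul_mul_assoc]

theorem expConj_sum {ι : Type*} (K : 𝔘) (t : ℝ) (s : Finset ι) (f : ι → 𝔘) :
    expConj K t (∑ i ∈ s, f i) = ∑ i ∈ s, expConj K t (f i) := by
  simp only [expConj, Finset.mul_sum, Finset.sum_mul]

theorem hasDerivAt_expConj (K X : 𝔘) (t : ℝ) :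
    HasDerivAt (fun s => expConj K s X) (expConj K t (K * X - X * K)) t := by
  have h1 := hasDerivAt_exp_smul_const (𝕂 := ℝ) K t
  have h2 : HasDerivAt (fun s : ℝ => NormedSpace.exp ((-s) • K))
      ((-1 : ℝ) • (K * NormedSpace.exp ((-t) • K))) t :=
    (hasDerivAt_exp_smul_const' (𝕂 := ℝ) K (-t)).scomp t (hasDerivAt_neg t)
  refine ((h1.mul_const X).mul h2).congr_deriv ?_
  rw [expConj, neg_one_smul]
  noncomm_ring

theorem exp_smul_mem_unitary {K : 𝔘} (hK : K ∈ skewAdjoint 𝔘) (t : ℝ) :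
    NormedSpace.exp (t • K) ∈ unitary 𝔘 := by
  let _ := NormedAlgebra.restrictScalars ℚ ℂ 𝔘
  exact NormedSpace.exp_mem_unitary_of_mem_skewAdjoint (skewAdjoint.smul_mem t hK)

theorem norm_expConj {K : 𝔘} (hK : K ∈ skewAdjoint 𝔘) (t : ℝ) (X : 𝔘) :
    ‖expConj K t X‖ = ‖X‖ := by
  rw [expConj, CStarRing.norm_mul_mem_unitary _ (exp_smul_mem_unitary hK _),
    CStarRing.norm_mem_unitary_mul _ (exp_smul_mem_unitary hK _)]

theorem star_exp_smul {K : 𝔘} (hK : K ∈ skewAdjoint 𝔘) (t : ℝ) :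
    star (NormedSpace.exp (t • K)) = NormedSpace.exp ((-t) • K) := by
  rw [NormedSpace.star_exp, star_smul, skewAdjoint.mem_iff.1 hK, smul_neg, neg_smul, star_trivial]

theorem expConj_mem_skewAdjoint {K : 𝔘} (hK : K ∈ skewAdjoint 𝔘) (t : ℝ) {X : 𝔘}
    (hX : X ∈ skewAdjoint 𝔘) : expConj K t X ∈ skewAdjoint 𝔘 := by
  rw [skewAdjoint.mem_iff, expConj, star_mul, star_mul, star_exp_smul hK, star_exp_smul hK,
    skewAdjoint.mem_iff.1 hX, neg_neg]
  noncomm_ring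

/-- The term `[K, f]` with skew-adjoint `K` does not contribute to the growth of `‖f‖`. -/
theorem frequently_slope_norm_lt {f : ℝ → 𝔘} {K g : 𝔘} {t r : ℝ} (hK : K ∈ skewAdjoint 𝔘)
    (hf : HasDerivAt f (K * f t - f t * K + g) t) (hr : ‖g‖ < r) :
    ∃ᶠ z in 𝓝[>] t, slope (fun s => ‖f s‖) t z < r := by
  -- In the frame rotated by `expConj K (t - s)` the norm of `f s` is unchanged, while the
  -- derivative at `t` loses the commutator with `K` and reduces to `g`.
  have h1 : HasDerivAt (fun s : ℝ => NormedSpace.exp ((t - s) • K)) ((-1 : ℝ) • K) t := by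
    have := (hasDerivAt_exp_smul_const (𝕂 := ℝ) K (t - t)).scomp t
      ((hasDerivAt_id t).const_sub t)
    exact this.congr_deriv (by simp [NormedSpace.exp_zero])
  have h2 : HasDerivAt (fun s : ℝ => NormedSpace.exp ((-(t - s)) • K)) K t := by
    have := (hasDerivAt_exp_smul_const (𝕂 := ℝ) K (-(t - t))).scomp t
      ((hasDerivAt_id t).const_sub t).neg
    exact this.congr_deriv (by simp [NormedSpace.exp_zero])
  have h3 : HasDerivAt (fun s => expConj K (t - s) (f s)) g t := by
    refine ((h1.mul hf).mul h2).congr_deriv ?_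
    simp only [Pi.mul_apply, sub_self, neg_zero, zero_smul, NormedSpace.exp_zero, neg_smul, one_smul]
    noncomm_ring
  refine (h3.hasDerivWithinAt.liminf_right_slope_norm_le hr).mono fun z hz => ?_
  rw [norm_expConj hK, norm_expConj hK] at hz
  rw [slope_def_field, div_eq_inv_mul]
  exact hz

end Conjugation

/-! ### Lieb–Robinson bounds in finite volume -/

section FiniteVolume

variable {D : ℕ} {𝔘 : Type*} [CStarAlgebra 𝔘] (Q : QuasiLocalAlgebra D 𝔘)
  {Φ : Finset (Lattice D) → 𝔘}

theorem I_smul_mem_skewAdjoint {X : 𝔘} (hX : IsSelfAdjoint X) : Complex.I • X ∈ skewAdjoint 𝔘 := by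
  rw [skewAdjoint.mem_iff, star_smul, hX.star_eq]
  simp

/-- Absorbing the imaginary unit gives a skew-adjoint generator and a real time parameter, as needed
for the differential inequality. -/
theorem localEvolution_eq_expConj (Φ : Finset (Lattice D) → 𝔘) (Λ : Finset (Lattice D)) (t : ℝ)
    (A : 𝔘) : localEvolution Φ Λ t A = expConj (Complex.I • hamiltonian Φ Λ) t A := by
  have h : ∀ s : ℝ, s • Complex.I • hamiltonian Φ Λ = (Complex.I * s) • hamiltonian Φ Λ := by
    intro s
    rw [mul_comm, mul_smul, Complex.coe_smul]
  rw [localEvolution, expConj, h, h]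
  simp

theorem isSelfAdjoint_sum_interaction (hΦ : ∀ X, IsSelfAdjoint (Φ X))
    (s : Finset (Finset (Lattice D))) : IsSelfAdjoint (∑ Z ∈ s, Φ Z) :=
  isSelfAdjoint_sum s fun Z _ => hΦ Z

/-- The regions in `Λ` that intersect `X`. -/
def touching (Λ X : Finset (Lattice D)) : Finset (Finset (Lattice D)) :=
  Λ.powerset.filter fun Z => (Z ∩ X).Nonempty

theorem mem_touching {Λ X Z : Finset (Lattice D)} :
    Z ∈ touching Λ X ↔ Z ⊆ Λ ∧ (Z ∩ X).Nonempty := by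
  simp [touching]

/-- Interaction terms disjoint from `X` commute with `A`. -/
theorem hamiltonian_commutator (hΦ : ∀ X, Φ X ∈ Q.region X) (Λ : Finset (Lattice D))
    {X : Finset (Lattice D)} {A : 𝔘} (hA : A ∈ Q.region X) :
    hamiltonian Φ Λ * A - A * hamiltonian Φ Λ =
      (∑ Z ∈ touching Λ X, Φ Z) * A - A * ∑ Z ∈ touching Λ X, Φ Z := by
  simp only [hamiltonian, touching, Finset.sum_mul, Finset.mul_sum, ← Finset.sum_sub_distrib]
  symm
  refine Finset.sum_subset (Finset.filter_subset _ _) fun Z hZ hZ' => ?_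
  have hd : Disjoint Z X := by
    rw [Finset.disjoint_iff_inter_eq_empty, ← Finset.not_nonempty_iff_eq_empty]
    exact fun h => hZ' (Finset.mem_filter.2 ⟨hZ, h⟩)
  rw [(Q.commute_of_disjoint hd (hΦ Z) hA).eq, sub_self]

/-- Growth of the commutator of an evolved observable with a fixed one. -/
theorem norm_commutator_localEvolution_le (hΦ : ∀ X, Φ X ∈ Q.region X)
    (hsa : ∀ X, IsSelfAdjoint (Φ X)) {Λ X : Finset (Lattice D)} {A B : 𝔘} (hA : A ∈ Q.region X)
    {b : Finset (Lattice D) → ℝ → ℝ}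
    (hb : ∀ Z ∈ touching Λ X, ∀ s, 0 ≤ s →
      ‖localEvolution Φ Λ s (Φ Z) * B - B * localEvolution Φ Λ s (Φ Z)‖ ≤ b Z s)
    {G G' : ℝ → ℝ} (hG : ∀ s, HasDerivAt G (G' s) s)
    (hbG : ∀ s, 0 ≤ s → 2 * ‖A‖ * ∑ Z ∈ touching Λ X, b Z s ≤ G' s)
    (h0 : ‖A * B - B * A‖ ≤ G 0) {t : ℝ} (ht : 0 ≤ t) :
    ‖localEvolution Φ Λ t A * B - B * localEvolution Φ Λ t A‖ ≤ G t := by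
  simp only [localEvolution_eq_expConj] at hb ⊢
  set K : 𝔘 := Complex.I • hamiltonian Φ Λ with hKdef
  have hK : K ∈ skewAdjoint 𝔘 := I_smul_mem_skewAdjoint (isSelfAdjoint_sum_interaction hsa _)
  set V : 𝔘 := Complex.I • ∑ Z ∈ touching Λ X, Φ Z with hVdef
  have hV : V ∈ skewAdjoint 𝔘 := I_smul_mem_skewAdjoint (isSelfAdjoint_sum_interaction hsa _)
  have hKV : K * A - A * K = V * A - A * V := by
    rw [hKdef, hVdef, smul_mul_assoc, mul_smul_comm, ← smul_sub, hamiltonian_commutator Q hΦ Λ hA,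
      smul_sub, smul_mul_assoc, mul_smul_comm]
  set f : ℝ → 𝔘 := fun s => expConj K s A * B - B * expConj K s A with hf
  set g : ℝ → 𝔘 := fun s => (expConj K s V * B - B * expConj K s V) * expConj K s A -
    expConj K s A * (expConj K s V * B - B * expConj K s V) with hg
  -- The Jacobi identity splits `[[V_s, A_s], B]` into `[V_s, [A_s, B]]`, which does not affect the
  -- norm, and `[[V_s, B], A_s]`, which involves only commutators of interaction terms with `B`.
  have hderiv : ∀ s, HasDerivAt f
      (expConj K s V * f s - f s * expConj K s V + g s) s := by
    intro s
    have h1 := hasDerivAt_expConj K A s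
    refine ((h1.mul_const B).sub (h1.const_mul B)).congr_deriv ?_
    rw [hKV, expConj_sub, expConj_mul, expConj_mul]
    simp only [hf, hg]
    noncomm_ring
  have hgle : ∀ s, 0 ≤ s → ‖g s‖ ≤ G' s := by
    intro s hs
    have hVB : ‖expConj K s V * B - B * expConj K s V‖ ≤ ∑ Z ∈ touching Λ X, b Z s := by
      rw [hVdef, expConj_smul, expConj_sum, smul_mul_assoc, mul_smul_comm, ← smul_sub, norm_smul,
        Complex.norm_I, one_mul, Finset.sum_mul, Finset.mul_sum, ← Finset.sum_sub_distrib]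
      exact norm_sum_le_of_le _ fun Z hZ => hb Z hZ s hs
    have hAs : ‖expConj K s A‖ = ‖A‖ := norm_expConj hK s A
    refine le_trans ?_ (hbG s hs)
    calc ‖g s‖ ≤ ‖expConj K s V * B - B * expConj K s V‖ * ‖A‖ +
          ‖A‖ * ‖expConj K s V * B - B * expConj K s V‖ := by
          rw [← hAs]
          exact norm_sub_le_of_le (norm_mul_le _ _) (norm_mul_le _ _)
      _ = 2 * ‖A‖ * ‖expConj K s V * B - B * expConj K s V‖ := by ring
      _ ≤ _ := by gcongr
  refine image_le_of_liminf_slope_right_le_deriv_boundary (f := fun s => ‖f s‖) (a := 0) (b := t)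
    (fun s _ => (hderiv s).continuousAt.norm.continuousWithinAt) (B := G) (B' := G') ?_
    (fun s _ => (hG s).continuousAt.continuousWithinAt) (fun s _ => (hG s).hasDerivWithinAt) ?_
    (Set.right_mem_Icc.2 ht)
  · simpa only [hf, expConj_zero] using h0
  · intro s hs r hr
    exact frequently_slope_norm_lt (expConj_mem_skewAdjoint hK s hV) (hderiv s)
      ((hgle s hs.1).trans_lt hr)

/-- Finite-volume Lieb–Robinson bound for a weight `w` that is almost preserved by the
interaction. -/
theorem norm_commutator_localEvolution_le_exp (hΦ : ∀ X, Φ X ∈ Q.region X)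
    (hsa : ∀ X, IsSelfAdjoint (Φ X)) {Λ : Finset (Lattice D)} {B : 𝔘}
    {w : Finset (Lattice D) → ℝ} {α φ M : ℝ}
    (hw : ∀ X ⊆ Λ, X.Nonempty → ∑ Z ∈ touching Λ X, ‖Φ Z‖ * w Z ≤ α * w X)
    (h0 : ∀ X ⊆ Λ, X.Nonempty → ∀ A ∈ Q.region X, ‖A * B - B * A‖ ≤ ‖A‖ * w X * φ)
    (hM : ∀ X ⊆ Λ, X.Nonempty → 2 * ‖B‖ ≤ w X * M) (hφ : 0 ≤ φ) (hM0 : 0 ≤ M) (hα : 0 ≤ α)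
    {X : Finset (Lattice D)} (hX : X ⊆ Λ) (hXne : X.Nonempty) {A : 𝔘} (hA : A ∈ Q.region X)
    {t : ℝ} (ht : 0 ≤ t) :
    ‖localEvolution Φ Λ t A * B - B * localEvolution Φ Λ t A‖ ≤
      ‖A‖ * w X * (φ * Real.exp (2 * α * t)) := by
  have hK : Complex.I • hamiltonian Φ Λ ∈ skewAdjoint 𝔘 :=
    I_smul_mem_skewAdjoint (isSelfAdjoint_sum_interaction hsa _)
  -- Iteration of the growth estimate, starting from the trivial bound `2 ‖A‖ ‖B‖`. After `k` rounds
  -- `M` carries the factor `(2αt)^k / k!`, so it drops out as `k → ∞` and may depend on the volume.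
  have key : ∀ k : ℕ, ∀ X ⊆ Λ, X.Nonempty → ∀ A ∈ Q.region X, ∀ t : ℝ, 0 ≤ t →
      ‖localEvolution Φ Λ t A * B - B * localEvolution Φ Λ t A‖ ≤
        ‖A‖ * w X * (φ * Real.exp (2 * α * t) + M * ((2 * α * t) ^ k / k.factorial)) := by
    intro k
    induction k with
    | zero =>
      intro X hX hXne A hA t ht
      have hwM := hM X hX hXne
      have hwX : 0 ≤ ‖A‖ * w X * (φ * Real.exp (2 * α * t)) := by
        have := (norm_nonneg _).trans (h0 X hX hXne A hA)
        have h2 := mul_nonneg this (Real.exp_nonneg (2 * α * t))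
        linarith
      have h1 : ‖localEvolution Φ Λ t A‖ = ‖A‖ := by
        rw [localEvolution_eq_expConj, norm_expConj hK]
      calc _ ≤ ‖A‖ * ‖B‖ + ‖B‖ * ‖A‖ := by
            rw [← h1]
            exact norm_sub_le_of_le (norm_mul_le _ _) (norm_mul_le _ _)
        _ = ‖A‖ * (2 * ‖B‖) := by ring
        _ ≤ ‖A‖ * (w X * M) := by gcongr
        _ ≤ _ := by simp only [pow_zero, Nat.factorial_zero, Nat.cast_one, div_one]; linarith
    | succ k ih =>
      intro X hX hXne A hA t ht
      refine norm_commutator_localEvolution_le Q hΦ hsa hA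
        (b := fun Z s => ‖Φ Z‖ * w Z *
          (φ * Real.exp (2 * α * s) + M * ((2 * α * s) ^ k / k.factorial)))
        (fun Z hZ s hs => ih Z (mem_touching.1 hZ).1
          ((mem_touching.1 hZ).2.mono Finset.inter_subset_left) _ (hΦ Z) s hs)
        (G := fun s => ‖A‖ * w X * (φ * Real.exp (2 * α * s) +
          M * ((2 * α * s) ^ (k + 1) / (k + 1).factorial)))
        (G' := fun s => ‖A‖ * w X * (φ * (Real.exp (2 * α * s) * (2 * α)) +
          M * ((2 * α * s) ^ k / k.factorial * (2 * α)))) ?_ ?_ ?_ ht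
      · intro s
        have h1 : HasDerivAt (fun s : ℝ => 2 * α * s) (2 * α) s := by
          simpa using (hasDerivAt_id s).const_mul (2 * α)
        refine ((((h1.exp).const_mul φ).add
          (((h1.pow (k + 1)).div_const ((k + 1).factorial : ℝ)).const_mul M)).const_mul
          (‖A‖ * w X)).congr_deriv ?_
        have hk : (k.factorial : ℝ) ≠ 0 := by exact_mod_cast k.factorial_ne_zero
        rw [Nat.factorial_succ]
        push_cast
        field_simp
      · intro s hs
        rw [← Finset.sum_mul]
        have hpos : 0 ≤ φ * Real.exp (2 * α * s) + M * ((2 * α * s) ^ k / k.factorial) := by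
          positivity
        calc _ ≤ 2 * ‖A‖ * ((α * w X) *
              (φ * Real.exp (2 * α * s) + M * ((2 * α * s) ^ k / k.factorial))) := by
              gcongr
              exact hw X hX hXne
          _ = _ := by ring
      · refine (h0 X hX hXne A hA).trans (le_of_eq ?_)
        simp
  have hlim : Tendsto (fun k : ℕ => ‖A‖ * w X * (φ * Real.exp (2 * α * t) +
      M * ((2 * α * t) ^ k / k.factorial))) atTop
      (𝓝 (‖A‖ * w X * (φ * Real.exp (2 * α * t) + M * 0))) :=
    (((FloorSemiring.tendsto_pow_div_factorial_atTop (2 * α * t)).const_mul M).const_add _).const_mul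
      _
  rw [mul_zero, add_zero] at hlim
  exact ge_of_tendsto' hlim fun k => key k X hX hXne A hA t ht

end FiniteVolume
end QSL
namespace QSL

/-! ### Lieb–Robinson bound for the infinite system -/

section LiebRobinson

variable {D : ℕ} {𝔘 : Type*} [CStarAlgebra 𝔘]

/-- Extracts bounds on finite sums from the suprema of infinite series; finite volumes require
nothing else. The maxima with `0` and `1` fix the signs of the constants. -/
theorem exists_interaction_constants {Φ : Finset (Lattice D) → 𝔘} (h : ExponentiallyDecaying Φ) :
    ∃ (l : ℝ) (F : ℕ → ℝ) (M C J : ℝ), 0 < l ∧ (∀ k, 0 < F k) ∧ 0 < M ∧ 0 ≤ C ∧ 0 ≤ J ∧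
      (∀ (x : Lattice D) (s : Finset (Lattice D)), ∑ y ∈ s, F (latDist x y) ≤ M) ∧
      (∀ (x y : Lattice D) (s : Finset (Lattice D)),
        ∑ z ∈ s, F (latDist x z) * F (latDist z y) ≤ C * F (latDist x y)) ∧
      ∀ (x y : Lattice D) (s : Finset (Finset (Lattice D))),
        ∑ Z ∈ s, (if x ∈ Z ∧ y ∈ Z then ‖Φ Z‖ else 0) ≤
          J * (Real.exp (-l * latDist x y) * F (latDist x y)) := by
  obtain ⟨l, F, hl, hF, ⟨M, hM⟩, ⟨C, hC⟩, ⟨J, hJ⟩⟩ := h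
  have hF' : ∀ k : ℕ, 0 < F k := fun k => hF k k.cast_nonneg
  refine ⟨l, fun k => F k, max M 1, max C 0, max J 0, hl, hF', by positivity, by positivity,
    by positivity, ?_, ?_, ?_⟩
  · intro x s
    exact (((hM x).1.sum_le_tsum s fun _ _ => (hF' _).le).trans (hM x).2).trans (le_max_left _ _)
  · intro x y s
    have h1 := ((hC x y).1.sum_le_tsum s fun z _ =>
      (div_pos (mul_pos (hF' _) (hF' _)) (hF' _)).le).trans (hC x y).2
    rw [← Finset.sum_div, div_le_iff₀ (hF' _)] at h1
    exact h1.trans (mul_le_mul_of_nonneg_right (le_max_left _ _) (hF' _).le)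
  · intro x y s
    have hpos : 0 < Real.exp (-l * latDist x y) * F (latDist x y) :=
      mul_pos (Real.exp_pos _) (hF' _)
    have h1 := ((hJ x y).1.sum_le_tsum (s.subtype fun Z => x ∈ Z ∧ y ∈ Z) fun Z _ =>
      div_nonneg (norm_nonneg _) hpos.le).trans (hJ x y).2
    rw [← Finset.sum_div, div_le_iff₀ hpos, Finset.sum_subtype_eq_sum_filter (f := fun Z => ‖Φ Z‖),
      Finset.sum_filter] at h1
    exact h1.trans (mul_le_mul_of_nonneg_right (le_max_left _ _) hpos.le)

/-- The sum of a pair weight over two regions. -/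
noncomputable def pairWeight (f : ℕ → ℝ) (X Y : Finset (Lattice D)) : ℝ :=
  ∑ x ∈ X, ∑ y ∈ Y, f (latDist x y)

theorem pairWeight_nonneg {f : ℕ → ℝ} (hf : ∀ k, 0 < f k) (X Y : Finset (Lattice D)) :
    0 ≤ pairWeight f X Y :=
  Finset.sum_nonneg fun _ _ => Finset.sum_nonneg fun _ _ => (hf _).le

theorem le_pairWeight {f : ℕ → ℝ} (hf : ∀ k, 0 < f k) {X Y : Finset (Lattice D)}
    {x : Lattice D} (hx : x ∈ X) : ∑ y ∈ Y, f (latDist x y) ≤ pairWeight f X Y :=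
  Finset.single_le_sum (f := fun x => ∑ y ∈ Y, f (latDist x y))
    (fun _ _ => Finset.sum_nonneg fun _ _ => (hf _).le) hx

theorem pairWeight_comm (f : ℕ → ℝ) (X Y : Finset (Lattice D)) :
    pairWeight f X Y = pairWeight f Y X := by
  unfold pairWeight
  rw [Finset.sum_comm]
  simp only [latDist_comm]

theorem pairWeight_le_card_mul {f : ℕ → ℝ} {c : ℝ}
    (hc : ∀ (x : Lattice D) (s : Finset (Lattice D)), ∑ y ∈ s, f (latDist x y) ≤ c)
    (X Y : Finset (Lattice D)) : pairWeight f X Y ≤ c * X.card := by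
  refine (Finset.sum_le_card_nsmul X _ c fun x _ => hc x Y).trans (le_of_eq ?_)
  rw [nsmul_eq_mul, mul_comm]

/-- The pair weight is symmetric, so either region may be the one whose points are counted. -/
theorem pairWeight_le_min {f : ℕ → ℝ} {c : ℝ}
    (hc : ∀ (x : Lattice D) (s : Finset (Lattice D)), ∑ y ∈ s, f (latDist x y) ≤ c)
    (X Y : Finset (Lattice D)) : pairWeight f X Y ≤ c * (min X.card Y.card : ℕ) := by
  rcases min_choice X.card Y.card with h | h <;> rw [h]
  · exact pairWeight_le_card_mul hc X Y
  · rw [pairWeight_comm]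
    exact pairWeight_le_card_mul hc Y X

theorem pairWeight_exp_le {F : ℕ → ℝ} {l : ℝ} (hl : 0 < l) (hF : ∀ k, 0 < F k)
    (X Y : Finset (Lattice D)) :
    pairWeight (fun k => Real.exp (-l * k) * F k) X Y ≤
      Real.exp (-l * setDist (X : Set (Lattice D)) Y) * pairWeight F X Y := by
  simp only [pairWeight, Finset.mul_sum]
  refine Finset.sum_le_sum fun x hx => Finset.sum_le_sum fun y hy => ?_
  have h : (setDist (X : Set (Lattice D)) Y : ℝ) ≤ latDist x y := by
    exact_mod_cast setDist_le (Finset.mem_coe.2 hx) (Finset.mem_coe.2 hy)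
  refine mul_le_mul_of_nonneg_right (Real.exp_le_exp.2 ?_) (hF _).le
  nlinarith

/-- The exponentially damped weight satisfies the same convolution inequality. -/
theorem sum_exp_mul_le {F : ℕ → ℝ} {l C : ℝ} (hl : 0 < l) (hF : ∀ k, 0 < F k)
    (hC : ∀ (x y : Lattice D) (s : Finset (Lattice D)),
      ∑ z ∈ s, F (latDist x z) * F (latDist z y) ≤ C * F (latDist x y))
    (x y : Lattice D) (s : Finset (Lattice D)) :
    ∑ z ∈ s, (Real.exp (-l * latDist x z) * F (latDist x z)) *
        (Real.exp (-l * latDist z y) * F (latDist z y)) ≤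
      C * (Real.exp (-l * latDist x y) * F (latDist x y)) := by
  calc _ ≤ ∑ z ∈ s, Real.exp (-l * latDist x y) * (F (latDist x z) * F (latDist z y)) := by
        refine Finset.sum_le_sum fun z _ => ?_
        have h : (latDist x y : ℝ) ≤ latDist x z + latDist z y := by
          exact_mod_cast latDist_triangle x z y
        have h2 : Real.exp (-l * latDist x z) * Real.exp (-l * latDist z y) ≤
            Real.exp (-l * latDist x y) := by
          rw [← Real.exp_add]
          exact Real.exp_le_exp.2 (by nlinarith)
        have h3 := mul_le_mul_of_nonneg_right h2
          (mul_pos (hF (latDist x z)) (hF (latDist z y))).le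
        linarith
    _ = Real.exp (-l * latDist x y) * ∑ z ∈ s, F (latDist x z) * F (latDist z y) := by
        rw [Finset.mul_sum]
    _ ≤ Real.exp (-l * latDist x y) * (C * F (latDist x y)) := by
        gcongr
        exact hC x y s
    _ = _ := by ring

/-- The interaction almost preserves the weight `pairWeight f · Y`. -/
theorem sum_touching_le {Φ : Finset (Lattice D) → 𝔘} {f : ℕ → ℝ} {C J : ℝ} (hf : ∀ k, 0 < f k)
    (hJ0 : 0 ≤ J)
    (hC : ∀ (x y : Lattice D) (s : Finset (Lattice D)),
      ∑ z ∈ s, f (latDist x z) * f (latDist z y) ≤ C * f (latDist x y))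
    (hJ : ∀ (x y : Lattice D) (s : Finset (Finset (Lattice D))),
        ∑ Z ∈ s, (if x ∈ Z ∧ y ∈ Z then ‖Φ Z‖ else 0) ≤ J * f (latDist x y))
    (Λ X Y : Finset (Lattice D)) :
    ∑ Z ∈ touching Λ X, ‖Φ Z‖ * pairWeight f Z Y ≤ J * C * pairWeight f X Y := by
  set G : Lattice D → ℝ := fun z => ∑ y ∈ Y, f (latDist z y) with hG
  have hG0 : ∀ z, 0 ≤ G z := fun z => Finset.sum_nonneg fun _ _ => (hf _).le
  -- Each `Z` that meets `X` is charged to all points of `Z ∩ X`, which only overcounts. For a fixed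
  -- pair `x, z` the decay of `Φ` sums over `Z` to `J * f (latDist x z)`, and the convolution
  -- inequality does the sum over `z`.
  calc ∑ Z ∈ touching Λ X, ‖Φ Z‖ * pairWeight f Z Y
      ≤ ∑ Z ∈ touching Λ X, ∑ x ∈ X, ∑ z ∈ Λ, (if x ∈ Z ∧ z ∈ Z then ‖Φ Z‖ else 0) * G z := by
        refine Finset.sum_le_sum fun Z hZ => ?_
        obtain ⟨hZΛ, x, hx⟩ := mem_touching.1 hZ
        rw [Finset.mem_inter] at hx
        have hpos : ∀ x ∈ X, 0 ≤ ∑ z ∈ Λ, (if x ∈ Z ∧ z ∈ Z then ‖Φ Z‖ else 0) * G z :=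
          fun x _ => Finset.sum_nonneg fun z _ => mul_nonneg (by positivity) (hG0 z)
        refine le_trans ?_ (Finset.single_le_sum hpos hx.2)
        rw [pairWeight, Finset.mul_sum]
        refine le_trans (le_of_eq ?_) (Finset.sum_le_sum_of_subset_of_nonneg hZΛ
          fun z _ _ => mul_nonneg (by positivity) (hG0 z))
        refine Finset.sum_congr rfl fun z hz => ?_
        rw [if_pos ⟨hx.1, hz⟩]
    _ = ∑ x ∈ X, ∑ z ∈ Λ,
          (∑ Z ∈ touching Λ X, if x ∈ Z ∧ z ∈ Z then ‖Φ Z‖ else 0) * G z := by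
        rw [Finset.sum_comm]
        refine Finset.sum_congr rfl fun x _ => ?_
        rw [Finset.sum_comm]
        simp only [Finset.sum_mul]
    _ ≤ ∑ x ∈ X, ∑ z ∈ Λ, (J * f (latDist x z)) * G z := by
        gcongr with x _ z _
        · exact hG0 z
        · exact hJ x z _
    _ = ∑ x ∈ X, ∑ y ∈ Y, J * ∑ z ∈ Λ, f (latDist x z) * f (latDist z y) := by
        refine Finset.sum_congr rfl fun x _ => ?_
        simp only [hG, Finset.mul_sum]
        rw [Finset.sum_comm]
        exact Finset.sum_congr rfl fun y _ => Finset.sum_congr rfl fun z _ => by ring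
    _ ≤ ∑ x ∈ X, ∑ y ∈ Y, J * (C * f (latDist x y)) := by
        gcongr with x _ y _
        exact hC x y Λ
    _ = _ := by
        simp only [pairWeight, Finset.mul_sum, mul_assoc]

/-- A short-range system has a Lieb–Robinson velocity. -/
theorem ShortRangeSystem.exists_isLiebRobinsonVelocity (S : ShortRangeSystem D 𝔘) :
    ∃ v, IsLiebRobinsonVelocity S.toLatticeSystem v := by
  obtain ⟨l, F, M, C, J, hl, hF, hM0, hC0, hJ0, hM, hC, hJ⟩ :=
    exists_interaction_constants S.Φ_decay
  set f : ℕ → ℝ := fun k => Real.exp (-l * k) * F k with hfdef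
  have hf : ∀ k, 0 < f k := fun k => mul_pos (Real.exp_pos _) (hF k)
  set α := J * C with hα
  have hα0 : 0 ≤ α := mul_nonneg hJ0 hC0
  have hfwd : ∀ (A B : 𝔘) (X Y : Finset (Lattice D)), A ∈ S.region X → B ∈ S.region Y →
      X.Nonempty → Y.Nonempty → ∀ t : ℝ, 0 ≤ t →
      ‖S.τ t A * B - B * S.τ t A‖ ≤
        ‖A‖ * pairWeight f X Y * (2 * ‖B‖ / f 0 * Real.exp (2 * α * t)) := by
    intro A B X Y hA hB hX hY t ht
    have hlim := S.τ_limit A t ⟨X, hA⟩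
    refine le_of_tendsto ((hlim.mul_const B).sub (hlim.const_mul B)).norm ?_
    filter_upwards [eventually_ge_atTop X] with Λ hΛ
    have hGpos : ∀ x, 0 < ∑ y ∈ Y, f (latDist x y) := fun x => Finset.sum_pos (fun _ _ => hf _) hY
    -- The constant `M` is crude and depends on `Λ`, which is harmless as it is absent from the
    -- conclusion.
    refine norm_commutator_localEvolution_le_exp S.toQuasiLocalAlgebra S.Φ_region S.Φ_selfAdjoint
      (w := fun X => pairWeight f X Y) (M := ∑ x ∈ Λ, 2 * ‖B‖ / ∑ y ∈ Y, f (latDist x y))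
      (fun X _ _ => sum_touching_le hf hJ0 (sum_exp_mul_le hl hF hC) hJ Λ X Y) ?_ ?_
      (div_nonneg (by positivity) (hf 0).le)
      (Finset.sum_nonneg fun x _ => div_nonneg (by positivity) (hGpos x).le) hα0 hΛ hX hA ht
    · intro X' hX' _ A' hA'
      -- Disjoint regions commute. Overlapping ones share a point, so their weight is at least `f
      -- 0`, which explains the factor `2 ‖B‖ / f 0`.
      by_cases hd : Disjoint X' Y
      · rw [(S.commute_of_disjoint hd hA' hB).eq, sub_self, norm_zero]
        have := pairWeight_nonneg hf X' Y
        have := (hf 0).le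
        positivity
      · obtain ⟨x, hx, hxY⟩ := Finset.not_disjoint_iff.1 hd
        have h1 : f 0 ≤ pairWeight f X' Y := by
          refine le_trans ?_ (le_pairWeight hf hx)
          rw [← latDist_self x]
          exact Finset.single_le_sum (f := fun y => f (latDist x y)) (fun _ _ => (hf _).le) hxY
        calc _ ≤ ‖A'‖ * ‖B‖ + ‖B‖ * ‖A'‖ := norm_sub_le_of_le (norm_mul_le _ _) (norm_mul_le _ _)
          _ = ‖A'‖ * f 0 * (2 * ‖B‖ / f 0) := by
              have := (hf 0).ne'
              field_simp
              ring
          _ ≤ _ := by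
              have := (hf 0).le
              gcongr
    · intro X' hX' hne
      obtain ⟨x, hx⟩ := hne
      calc 2 * ‖B‖ = (∑ y ∈ Y, f (latDist x y)) * (2 * ‖B‖ / ∑ y ∈ Y, f (latDist x y)) := by
            rw [mul_div_cancel₀ _ (hGpos x).ne']
        _ ≤ _ := by
            refine mul_le_mul (le_pairWeight hf hx) ?_ (div_nonneg (by positivity) (hGpos x).le)
              (pairWeight_nonneg hf _ _)
            exact Finset.single_le_sum (f := fun x => 2 * ‖B‖ / ∑ y ∈ Y, f (latDist x y))
              (fun x _ => div_nonneg (by positivity) (hGpos x).le) (hX' hx)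
  have hboth : ∀ (A B : 𝔘) (X Y : Finset (Lattice D)), A ∈ S.region X → B ∈ S.region Y →
      X.Nonempty → Y.Nonempty → ∀ t : ℝ,
      ‖S.τ t A * B - B * S.τ t A‖ ≤
        2 / f 0 * ‖A‖ * ‖B‖ * pairWeight f X Y * Real.exp (2 * α * |t|) := by
    intro A B X Y hA hB hX hY t
    rcases le_total 0 t with ht | ht
    · refine (hfwd A B X Y hA hB hX hY t ht).trans (le_of_eq ?_)
      rw [abs_of_nonneg ht]
      ring
    -- For negative times apply the automorphism `τ_{-t}`, which exchanges the roles of `A` and `B`.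
    · have h1 : S.τ t A * B - B * S.τ t A =
          S.τ t (-(S.τ (-t) B * A - A * S.τ (-t) B)) := by
        have h2 : S.τ t (S.τ (-t) B) = B := by
          rw [← S.τ_add, add_neg_cancel, S.τ_zero]
        rw [map_neg, map_sub, map_mul, map_mul, h2]
        abel
      rw [h1, S.norm_τ, norm_neg]
      refine (hfwd B A Y X hB hA hY hX (-t) (by linarith)).trans (le_of_eq ?_)
      rw [abs_of_nonpos ht, pairWeight_comm]
      ring
  -- The growth rate `2 * α` divided by the spatial decay rate `l`; the extra `1` keeps the velocity
  -- positive when `α = 0`.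
  refine ⟨(2 * α + 1) / l, by positivity, 2 / f 0 * M, l,
    mul_pos (div_pos two_pos (hf 0)) hM0, hl, ?_⟩
  intro A B t hA hB
  have hnn : 0 ≤ 2 / f 0 * M * ‖A‖ * ‖B‖ * (min (S.supp A).ncard (S.supp B).ncard : ℕ) *
      Real.exp (-l * (setDist (S.supp A) (S.supp B) - (2 * α + 1) / l * |t|)) := by
    have := (hf 0).le
    positivity
  obtain ⟨X, hX, hAX⟩ := hA.exists_region_eq_supp
  obtain ⟨Y, hY, hBY⟩ := hB.exists_region_eq_supp
  rcases X.eq_empty_or_nonempty with rfl | hXne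
  · obtain ⟨c, rfl⟩ := S.exists_algebraMap_of_supp_eq_empty hA (by rw [← hX, Finset.coe_empty])
    rw [AlgHomClass.commutes, Algebra.commutes, sub_self, norm_zero]
    exact hnn
  rcases Y.eq_empty_or_nonempty with rfl | hYne
  · obtain ⟨c, rfl⟩ := S.exists_algebraMap_of_supp_eq_empty hB (by rw [← hY, Finset.coe_empty])
    rw [Algebra.commutes, sub_self, norm_zero]
    exact hnn
  rw [← hX, ← hY, Set.ncard_coe_finset, Set.ncard_coe_finset]
  have hexp : Real.exp (-l * setDist (X : Set (Lattice D)) Y) * Real.exp (2 * α * |t|) ≤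
      Real.exp (-l * (setDist (X : Set (Lattice D)) Y - (2 * α + 1) / l * |t|)) := by
    rw [← Real.exp_add]
    refine Real.exp_le_exp.2 ?_
    have : l * ((2 * α + 1) / l * |t|) = (2 * α + 1) * |t| := by field_simp
    have := abs_nonneg t
    linarith
  have hpw : pairWeight f X Y ≤ Real.exp (-l * setDist (X : Set (Lattice D)) Y) *
      (M * (min X.card Y.card : ℕ)) :=
    (pairWeight_exp_le hl hF X Y).trans
      (mul_le_mul_of_nonneg_left (pairWeight_le_min hM X Y) (Real.exp_nonneg _))
  have hf0 := hf 0
  calc _ ≤ 2 / f 0 * ‖A‖ * ‖B‖ * pairWeight f X Y * Real.exp (2 * α * |t|) :=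
        hboth A B X Y hAX hBY hXne hYne t
    _ ≤ 2 / f 0 * ‖A‖ * ‖B‖ * (Real.exp (-l * setDist (X : Set (Lattice D)) Y) *
          (M * (min X.card Y.card : ℕ))) * Real.exp (2 * α * |t|) := by gcongr
    _ = 2 / f 0 * M * ‖A‖ * ‖B‖ * (min X.card Y.card : ℕ) *
          (Real.exp (-l * setDist (X : Set (Lattice D)) Y) * Real.exp (2 * α * |t|)) := by ring
    _ ≤ _ := by gcongr

theorem IsLiebRobinsonVelocity.mono {S : LatticeSystem D 𝔘} {v w : ℝ}
    (h : IsLiebRobinsonVelocity S v) (hvw : v ≤ w) : IsLiebRobinsonVelocity S w := by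
  obtain ⟨hv, L, l, hL, hl, hb⟩ := h
  refine ⟨hv.trans_le hvw, L, l, hL, hl, fun A B t hA hB => (hb A B t hA hB).trans ?_⟩
  have : v * |t| ≤ w * |t| := mul_le_mul_of_nonneg_right hvw (abs_nonneg t)
  refine mul_le_mul_of_nonneg_left (Real.exp_le_exp.2 ?_) (by positivity)
  nlinarith

end LiebRobinson
end QSL
namespace QSL

/-! ### Set partitions as families of blocks -/

section Partitions

variable {n : ℕ} {s : Finset (Fin n)} {i : Fin n}

/-- The partitions of `s`, as families of blocks. -/
def partitions (s : Finset (Fin n)) : Finset (Finset (Finset (Fin n))) :=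
  Finset.univ.image fun π : Finpartition s => π.parts

theorem mem_partitions {Q : Finset (Finset (Fin n))} :
    Q ∈ partitions s ↔ ∅ ∉ Q ∧ (∀ x, x ∈ s ↔ ∃ W ∈ Q, x ∈ W) ∧
      ∀ W ∈ Q, ∀ W' ∈ Q, ∀ x, x ∈ W → x ∈ W' → W = W' := by
  simp only [partitions, Finset.mem_image, Finset.mem_univ, true_and]
  constructor
  · rintro ⟨π, rfl⟩
    exact ⟨π.bot_notMem, fun x => ⟨π.exists_mem, fun ⟨W, hW, hx⟩ => π.subset hW hx⟩,
      fun W hW W' hW' x hx hx' => π.eq_of_mem_parts hW hW' hx hx'⟩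
  · rintro ⟨h1, h2, h3⟩
    exact ⟨Finpartition.ofExistsUnique Q (fun W hW x hx => (h2 x).2 ⟨W, hW, hx⟩)
      (fun x hx => by
        obtain ⟨W, hW, hxW⟩ := (h2 x).1 hx
        exact ⟨W, ⟨hW, hxW⟩, fun W' hW' => h3 _ hW'.1 _ hW x hW'.2 hxW⟩) h1, rfl⟩

/-- The type `Finpartition s` depends on `s`, while families of blocks do not; this permits
bijections between partitions of different sets. -/
theorem sum_finpartition_eq (F : Finset (Finset (Fin n)) → ℂ) :
    ∑ π : Finpartition s, F π.parts = ∑ Q ∈ partitions s, F Q := by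
  rw [partitions, Finset.sum_image]
  exact fun π _ π' _ h => Finpartition.ext h

/-- A partition of `insert i s` arises from a partition of `s` by adding `i` to one of its blocks or
to the empty set. -/
theorem sum_partitions_insert (hi : i ∉ s) (F : Finset (Finset (Fin n)) → ℂ) :
    ∑ R ∈ partitions (insert i s), F R =
      ∑ Q ∈ partitions s, ∑ W ∈ insert ∅ Q, F (insert (insert i W) (Q.erase W)) := by
  symm
  rw [Finset.sum_sigma']
  refine Finset.sum_nbij (fun p => insert (insert i p.2) (p.1.erase p.2)) ?_ ?_ ?_ fun _ _ => rfl
  · rintro ⟨Q, W⟩ h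
    simp only [Finset.mem_sigma, mem_partitions] at h ⊢
    obtain ⟨⟨h1, h2, h3⟩, h4⟩ := h
    refine ⟨?_, ?_, ?_⟩
    · grind
    · intro x
      by_cases hx : x ∈ W <;> grind
    · grind
  · rintro ⟨Q, W⟩ h ⟨Q', W'⟩ h' heq
    simp only [Finset.coe_sigma, Set.mem_sigma_iff, Finset.mem_coe, mem_partitions] at h h'
    obtain ⟨⟨h1, h2, h3⟩, h4⟩ := h
    obtain ⟨⟨h1', h2', h3'⟩, h4'⟩ := h'
    simp only at heq
    have hQ : ∀ V ∈ insert ∅ Q, i ∉ V := by grind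
    have hQ' : ∀ V ∈ insert ∅ Q', i ∉ V := by grind
    have hW : W = W' := by
      have h5 : insert i W ∈ insert (insert i W') (Q'.erase W') := by
        rw [← heq]
        exact Finset.mem_insert_self _ _
      have h6 : insert i W = insert i W' := by grind
      have h7 := congrArg (fun V => V.erase i) h6
      simpa [Finset.erase_insert (hQ W h4), Finset.erase_insert (hQ' W' h4')] using h7
    subst hW
    have h8 : Q.erase W = Q'.erase W := by
      have h7 := congrArg (fun V => V.erase (insert i W)) heq
      have h9 : insert i W ∉ Q.erase W := by grind
      have h10 : insert i W ∉ Q'.erase W := by grind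
      simpa [Finset.erase_insert h9, Finset.erase_insert h10] using h7
    have h11 : Q = Q' := by
      ext V
      -- If `W` is empty it belongs to neither family, otherwise to both.
      by_cases hV : V = W
      · subst hV
        by_cases h0 : V = ∅ <;> grind
      · have := congrArg (fun Z => V ∈ Z) h8
        simpa [hV] using this
    subst h11
    rfl
  · intro R hR
    rw [Finset.mem_coe, mem_partitions] at hR
    obtain ⟨h1, h2, h3⟩ := hR
    obtain ⟨W₀, hW₀, hiW₀⟩ := (h2 i).1 (Finset.mem_insert_self _ _)
    -- Delete `i` from its block `W₀`; if `W₀ = {i}`, this leaves the empty set, which must be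
    -- discarded from the family.
    refine ⟨⟨(insert (W₀.erase i) (R.erase W₀)).erase ∅, W₀.erase i⟩, ?_, ?_⟩
    · simp only [Finset.coe_sigma, Set.mem_sigma_iff, Finset.mem_coe, mem_partitions]
      refine ⟨⟨by simp, ?_, ?_⟩, ?_⟩
      · intro x
        simp only [Finset.mem_erase, Finset.mem_insert, ne_eq]
        constructor
        · intro hx
          obtain ⟨W, hW, hxW⟩ := (h2 x).1 (Finset.mem_insert_of_mem hx)
          have hxi : x ≠ i := by
            rintro rfl
            exact hi hx
          by_cases hWW : W = W₀
          · subst hWW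
            have h5 : x ∈ W.erase i := Finset.mem_erase.2 ⟨hxi, hxW⟩
            exact ⟨W.erase i, ⟨Finset.ne_empty_of_mem h5, Or.inl rfl⟩, h5⟩
          · exact ⟨W, ⟨Finset.ne_empty_of_mem hxW, Or.inr ⟨hWW, hW⟩⟩, hxW⟩
        · rintro ⟨W, ⟨-, rfl | ⟨hne, hW⟩⟩, hxW⟩
          · rw [Finset.mem_erase] at hxW
            exact Finset.mem_of_mem_insert_of_ne ((h2 x).2 ⟨W₀, hW₀, hxW.2⟩) hxW.1
          · refine Finset.mem_of_mem_insert_of_ne ((h2 x).2 ⟨W, hW, hxW⟩) ?_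
            rintro rfl
            exact hne (h3 _ hW _ hW₀ _ hxW hiW₀)
      · intro W hW W' hW' x hx hx'
        grind
      · by_cases h0 : W₀.erase i = ∅ <;> simp [h0]
    · simp only [Finset.insert_erase hiW₀]
      have : ((insert (W₀.erase i) (R.erase W₀)).erase ∅).erase (W₀.erase i) = R.erase W₀ := by
        ext V
        simp only [Finset.mem_erase, Finset.mem_insert, ne_eq]
        constructor
        · grind
        · rintro ⟨hV, hVR⟩
          refine ⟨?_, ?_, Or.inr ⟨hV, hVR⟩⟩
          · rintro rfl
            obtain ⟨x, hx⟩ : (W₀.erase i).Nonempty := by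
              rw [Finset.nonempty_iff_ne_empty]
              rintro h
              exact h1 (h ▸ hVR)
            exact hV (h3 _ hVR _ hW₀ x hx (Finset.mem_of_mem_erase hx))
          · rintro rfl
            exact h1 hVR
      rw [this, Finset.insert_erase hW₀]

theorem prod_partition_prod {M : Type*} [CommMonoid M] (π : Finpartition s) (b : Fin n → M) :
    ∏ W ∈ π.parts, ∏ j ∈ W, b j = ∏ j ∈ s, b j := by
  conv_rhs => rw [← π.biUnion_parts]
  rw [Finset.prod_biUnion π.disjoint]
  rfl

/-- Exactly one block contains `i`, so the small factor occurs exactly once. -/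
theorem prod_ite_mem_parts (π : Finpartition s) (hi : i ∈ s) (ε : ℝ) :
    ∏ W ∈ π.parts, (if i ∈ W then ε else 1) = ε := by
  rw [Finset.prod_eq_single (π.part i)]
  · rw [if_pos (π.mem_part hi)]
  · intro W hW hne
    rw [if_neg]
    intro h
    exact hne (π.eq_of_mem_parts hW (π.part_mem.2 hi) h (π.mem_part hi))
  · intro h
    exact absurd (π.part_mem.2 hi) h

end Partitions
end QSL
namespace QSL

/-! ### Cumulant bounds from almost factorizing moments -/

section Cumulants

variable {n : ℕ} {𝔘 : Type*} [CStarAlgebra 𝔘]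

/-- Classical cumulants are small if the moments almost factorize at the index `i`. -/
theorem exists_norm_classicalCumulant_le (𝔘 : Type*) [CStarAlgebra 𝔘] (hn : 2 ≤ n) (i : Fin n) :
    ∃ C : ℝ, 0 ≤ C ∧ ∀ (ω : 𝔘 →L[ℂ] ℂ) (A : Fin n → 𝔘) (b : Fin n → ℝ) (ε : ℝ),
      (∀ W, ‖moment ω A W‖ ≤ ∏ j ∈ W, b j) →
      (∀ W, i ∈ W → ‖moment ω A W - moment ω A (W.erase i) * moment ω A {i}‖ ≤
        ε * ∏ j ∈ W, b j) →
      ‖classicalCumulant ω A‖ ≤ C * ε * ∏ j, b j := by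
  set s : Finset (Fin n) := Finset.univ.erase i with hs
  have his : i ∉ s := Finset.notMem_erase _ _
  have hsne : s.Nonempty := by
    rw [← Finset.card_pos, hs, Finset.card_erase_of_mem (Finset.mem_univ i), Finset.card_fin]
    omega
  refine ⟨∑ Q ∈ partitions s, ∑ W ∈ Q, ((Q.card - 1).factorial : ℝ),
    Finset.sum_nonneg fun _ _ => Finset.sum_nonneg fun _ _ => Nat.cast_nonneg _, ?_⟩
  intro ω A b ε hm hf
  set m := moment ω A with hmdef
  have h1 : classicalCumulant ω A = ∑ R ∈ partitions (insert i s),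
      (-1 : ℂ) ^ (R.card - 1) * ((R.card - 1).factorial : ℂ) * ∏ V ∈ R, m V := by
    rw [hs, Finset.insert_erase (Finset.mem_univ i), ← sum_finpartition_eq]
    rfl
  rw [h1, sum_partitions_insert his, Finset.sum_mul, Finset.sum_mul]
  refine norm_sum_le_of_le _ fun Q hQ => ?_
  obtain ⟨hQ1, hQ2, hQ3⟩ := mem_partitions.1 hQ
  have hiQ : ∀ W ∈ Q, i ∉ W := fun W hW hiW => his ((hQ2 i).2 ⟨W, hW, hiW⟩)
  have hQpos : 0 < Q.card := by
    obtain ⟨x, hx⟩ := hsne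
    obtain ⟨W, hW, -⟩ := (hQ2 x).1 hx
    exact Finset.card_pos.2 ⟨W, hW⟩
  have hprod : ∏ W ∈ Q, ∏ j ∈ W, b j = ∏ j ∈ s, b j := by
    obtain ⟨π, -, rfl⟩ := Finset.mem_image.1 hQ
    exact prod_partition_prod π b
  set c : ℂ := (-1 : ℂ) ^ (Q.card - 1) * ((Q.card - 1).factorial : ℂ) with hc
  -- The coefficient for one more block is `-Q.card` times the coefficient `c` for `Q`. Hence the
  -- term with `{i}` as a new block supplies one subtraction `m W * m {i}` for each of the `Q.card`
  -- ways to put `i` into a block.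
  have hc' : (-1 : ℂ) ^ Q.card * (Q.card.factorial : ℂ) = -(Q.card * c) := by
    obtain ⟨k, hk⟩ : ∃ k, Q.card = k + 1 := ⟨Q.card - 1, by omega⟩
    rw [hc, hk, Nat.factorial_succ, Nat.add_sub_cancel]
    push_cast
    ring
  have hW : ∀ W ∈ Q, insert i W ∉ Q.erase W := fun W _ h =>
    hiQ _ (Finset.mem_of_mem_erase h) (Finset.mem_insert_self _ _)
  have hsum : ∑ W ∈ insert ∅ Q, ((-1 : ℂ) ^ ((insert (insert i W) (Q.erase W)).card - 1) *
      (((insert (insert i W) (Q.erase W)).card - 1).factorial : ℂ) *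
        ∏ V ∈ insert (insert i W) (Q.erase W), m V) =
      ∑ W ∈ Q, c * ((m (insert i W) - m W * m {i}) * ∏ V ∈ Q.erase W, m V) := by
    rw [Finset.sum_insert hQ1, Finset.erase_eq_of_notMem hQ1, insert_empty_eq]
    have hiQ' : {i} ∉ Q := fun h => hiQ _ h (Finset.mem_singleton_self i)
    rw [Finset.card_insert_of_notMem hiQ', Finset.prod_insert hiQ', Nat.add_sub_cancel, hc']
    have h2 : ∀ W ∈ Q, ((-1 : ℂ) ^ ((insert (insert i W) (Q.erase W)).card - 1) *
        (((insert (insert i W) (Q.erase W)).card - 1).factorial : ℂ) *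
          ∏ V ∈ insert (insert i W) (Q.erase W), m V) =
        c * ((m (insert i W) - m W * m {i}) * ∏ V ∈ Q.erase W, m V) +
          c * (m {i} * ∏ V ∈ Q, m V) := by
      intro W hWQ
      rw [Finset.card_insert_of_notMem (hW W hWQ), Finset.prod_insert (hW W hWQ),
        Finset.card_erase_add_one hWQ, ← Finset.mul_prod_erase Q m hWQ]
      ring
    rw [Finset.sum_congr rfl h2, Finset.sum_add_distrib, Finset.sum_const, nsmul_eq_mul]
    ring
  rw [hsum, Finset.sum_mul, Finset.sum_mul]
  refine norm_sum_le_of_le _ fun W hWQ => ?_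
  have hcn : ‖c‖ = ((Q.card - 1).factorial : ℝ) := by
    rw [hc, norm_mul, norm_pow, norm_neg, norm_one, one_pow, one_mul, Complex.norm_natCast]
  have h3 := hf (insert i W) (Finset.mem_insert_self _ _)
  rw [Finset.erase_insert (hiQ W hWQ), Finset.prod_insert (hiQ W hWQ)] at h3
  have h4 : ‖∏ V ∈ Q.erase W, m V‖ ≤ ∏ V ∈ Q.erase W, ∏ j ∈ V, b j := by
    rw [norm_prod]
    exact Finset.prod_le_prod (fun _ _ => norm_nonneg _) fun V _ => hm V
  calc ‖c * ((m (insert i W) - m W * m {i}) * ∏ V ∈ Q.erase W, m V)‖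
      = ((Q.card - 1).factorial : ℝ) * (‖m (insert i W) - m W * m {i}‖ *
          ‖∏ V ∈ Q.erase W, m V‖) := by rw [norm_mul c, norm_mul (_ - _), hcn]
    _ ≤ ((Q.card - 1).factorial : ℝ) * ((ε * (b i * ∏ j ∈ W, b j)) *
          ∏ V ∈ Q.erase W, ∏ j ∈ V, b j) := by
        refine mul_le_mul_of_nonneg_left ?_ (by positivity)
        exact mul_le_mul h3 h4 (norm_nonneg _) ((norm_nonneg _).trans h3)
    _ = ((Q.card - 1).factorial : ℝ) * ε * (b i * ((∏ j ∈ W, b j) *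
          ∏ V ∈ Q.erase W, ∏ j ∈ V, b j)) := by ring
    _ = ((Q.card - 1).factorial : ℝ) * ε * ∏ j, b j := by
        rw [Finset.mul_prod_erase Q (fun V => ∏ j ∈ V, b j) hWQ, hprod, hs,
          Finset.mul_prod_erase _ _ (Finset.mem_univ i)]

/-- The non-crossing condition for a family of blocks. -/
def NonCrossingFamily (Q : Finset (Finset (Fin n))) : Prop :=
  ∀ W₁ ∈ Q, ∀ W₂ ∈ Q, W₁ ≠ W₂ →
    ∀ a ∈ W₁, ∀ b ∈ W₂, ∀ c ∈ W₁, ∀ d ∈ W₂, ¬ (a < b ∧ b < c ∧ c < d)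

open Classical in
theorem freeCumulantOn_eq_sub_sum (ω : 𝔘 →L[ℂ] ℂ) (A : Fin n → 𝔘) (V : Finset (Fin n)) :
    freeCumulantOn ω A V = moment ω A V - ∑ Q ∈ partitions V,
      if NonCrossingFamily Q ∧ Q ≠ {V} then ∏ W ∈ Q, freeCumulantOn ω A W else 0 := by
  rw [freeCumulantOn, ← sum_finpartition_eq, ← Finset.sum_filter]
  congr 1
  rw [Finset.sum_subtype (p := fun π : Finpartition V => NonCrossing π ∧ π.parts ≠ {V}) _
    (fun π => by simp [NonCrossing, NonCrossingFamily])
    (fun π : Finpartition V => ∏ W ∈ π.parts, freeCumulantOn ω A W)]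
  exact Finset.sum_congr rfl fun π _ => Finset.prod_coe_sort π.1.parts (freeCumulantOn ω A)

open Classical in
theorem moment_eq_sum_partitions (ω : 𝔘 →L[ℂ] ℂ) (A : Fin n → 𝔘) (V : Finset (Fin n))
    (hV : V.Nonempty) :
    moment ω A V = ∑ Q ∈ partitions V,
      if NonCrossingFamily Q then ∏ W ∈ Q, freeCumulantOn ω A W else 0 := by
  rw [moment_eq_sum_freeCumulantOn ω A V hV, ← sum_finpartition_eq, ← Finset.sum_filter,
    Finset.sum_subtype (p := fun π : Finpartition V => NonCrossing π) _
    (fun π => by simp [NonCrossing, NonCrossingFamily])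
    (fun π : Finpartition V => ∏ W ∈ π.parts, freeCumulantOn ω A W)]

/-- The only partition of a singleton has one block, so the recursion has nothing to subtract. -/
theorem freeCumulantOn_singleton (ω : 𝔘 →L[ℂ] ℂ) (A : Fin n → 𝔘) (i : Fin n) :
    freeCumulantOn ω A {i} = moment ω A {i} := by
  classical
  rw [freeCumulantOn_eq_sub_sum, Finset.sum_eq_zero, sub_zero]
  intro Q hQ
  obtain ⟨h1, h2, -⟩ := mem_partitions.1 hQ
  rw [if_neg]
  rintro ⟨-, hne⟩
  apply hne
  obtain ⟨W, hW, -⟩ := (h2 i).1 (Finset.mem_singleton_self i)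
  refine Finset.eq_singleton_iff_nonempty_unique_mem.2 ⟨⟨W, hW⟩, fun U hU => ?_⟩
  have hU0 : U.Nonempty := Finset.nonempty_iff_ne_empty.2 fun h => h1 (h ▸ hU)
  exact Finset.eq_singleton_iff_nonempty_unique_mem.2
    ⟨hU0, fun x hx => Finset.mem_singleton.1 ((h2 x).2 ⟨U, hU, hx⟩)⟩

theorem card_lt_of_mem_partitions {V W : Finset (Fin n)} {Q : Finset (Finset (Fin n))}
    (hQ : Q ∈ partitions V) (hne : Q ≠ {V}) (hW : W ∈ Q) : W.card < V.card := by
  obtain ⟨π, -, rfl⟩ := Finset.mem_image.1 hQ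
  exact card_lt_of_parts_ne π hne hW

/-- Free cumulants are bounded by the bounds of the moments. -/
theorem exists_norm_freeCumulantOn_le (𝔘 : Type*) [CStarAlgebra 𝔘] (V : Finset (Fin n)) :
    ∃ C : ℝ, 0 ≤ C ∧ ∀ (ω : 𝔘 →L[ℂ] ℂ) (A : Fin n → 𝔘) (b : Fin n → ℝ),
      (∀ j, 0 ≤ b j) → (∀ W, ‖moment ω A W‖ ≤ ∏ j ∈ W, b j) →
      ‖freeCumulantOn ω A V‖ ≤ C * ∏ j ∈ V, b j := by
  classical
  induction hk : V.card using Nat.strong_induction_on generalizing V with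
  | _ k ih =>
    subst hk
    have ih' : ∀ W : Finset (Fin n), W.card < V.card → ∃ C : ℝ, 0 ≤ C ∧
        ∀ (ω : 𝔘 →L[ℂ] ℂ) (A : Fin n → 𝔘) (b : Fin n → ℝ),
        (∀ j, 0 ≤ b j) → (∀ W, ‖moment ω A W‖ ≤ ∏ j ∈ W, b j) →
        ‖freeCumulantOn ω A W‖ ≤ C * ∏ j ∈ W, b j := fun W hW => ih _ hW W rfl
    choose! C hC0 hC using ih'
    refine ⟨1 + ∑ Q ∈ partitions V, |∏ W ∈ Q, C W|, by positivity, ?_⟩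
    intro ω A b hb hm
    have hbV : 0 ≤ ∏ j ∈ V, b j := Finset.prod_nonneg fun j _ => hb j
    rw [freeCumulantOn_eq_sub_sum, add_mul, one_mul, Finset.sum_mul]
    refine norm_sub_le_of_le (hm V) (norm_sum_le_of_le _ fun Q hQ => ?_)
    split_ifs with h
    · calc ‖∏ W ∈ Q, freeCumulantOn ω A W‖ ≤ ∏ W ∈ Q, (C W * ∏ j ∈ W, b j) := by
            rw [norm_prod]
            exact Finset.prod_le_prod (fun _ _ => norm_nonneg _) fun W hW =>
              hC W (card_lt_of_mem_partitions hQ h.2 hW) ω A b hb hm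
        _ = (∏ W ∈ Q, C W) * ∏ j ∈ V, b j := by
            obtain ⟨π, -, rfl⟩ := Finset.mem_image.1 hQ
            rw [Finset.prod_mul_distrib, prod_partition_prod]
        _ ≤ _ := mul_le_mul_of_nonneg_right (le_abs_self _) hbV
    · rw [norm_zero]
      positivity

open Classical in
/-- The non-crossing partitions with the block `{i}` are those of the remaining indices. -/
theorem sum_partitions_singleton_mem (f : Finset (Fin n) → ℂ) {V : Finset (Fin n)} {i : Fin n}
    (hi : i ∈ V) (hV : V ≠ {i}) :
    ∑ Q ∈ partitions V with {i} ∈ Q,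
        (if NonCrossingFamily Q ∧ Q ≠ {V} then ∏ W ∈ Q, f W else 0) =
      f {i} * ∑ Q ∈ partitions (V.erase i),
        if NonCrossingFamily Q then ∏ W ∈ Q, f W else 0 := by
  have hnot : ∀ Q ∈ partitions (V.erase i), {i} ∉ Q := by
    intro Q hQ h
    obtain ⟨-, h2, -⟩ := mem_partitions.1 hQ
    exact Finset.notMem_erase i V ((h2 i).2 ⟨_, h, Finset.mem_singleton_self i⟩)
  -- A crossing needs two different points in each of its two blocks, so the block `{i}` never takes
  -- part in one.
  have hNC : ∀ Q ∈ partitions (V.erase i),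
      (NonCrossingFamily (insert {i} Q) ∧ insert {i} Q ≠ {V}) ↔ NonCrossingFamily Q := by
    intro Q hQ
    constructor
    · exact fun h W₁ h₁ W₂ h₂ => h.1 W₁ (Finset.mem_insert_of_mem h₁) W₂
        (Finset.mem_insert_of_mem h₂)
    · refine fun h => ⟨?_, ?_⟩
      · intro W₁ h₁ W₂ h₂ hne a ha b hb c hc d hd hlt
        rw [Finset.mem_insert] at h₁ h₂
        rcases h₁ with rfl | h₁
        · rw [Finset.mem_singleton] at ha hc
          subst ha hc
          exact lt_asymm hlt.1 hlt.2.1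
        rcases h₂ with rfl | h₂
        · rw [Finset.mem_singleton] at hb hd
          subst hb hd
          exact lt_asymm hlt.2.1 hlt.2.2
        exact h W₁ h₁ W₂ h₂ hne a ha b hb c hc d hd hlt
      · intro h'
        have : {i} ∈ ({V} : Finset (Finset (Fin n))) := h' ▸ Finset.mem_insert_self _ _
        exact hV (Finset.mem_singleton.1 this).symm
  rw [Finset.mul_sum]
  symm
  refine Finset.sum_bij' (fun Q _ => insert {i} Q) (fun Q _ => Q.erase {i}) ?_ ?_ ?_ ?_ ?_
  · intro Q hQ
    obtain ⟨h1, h2, h3⟩ := mem_partitions.1 hQ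
    rw [Finset.mem_filter, mem_partitions]
    refine ⟨⟨?_, ?_, ?_⟩, Finset.mem_insert_self _ _⟩
    · simp [h1]
    · intro x
      by_cases hx : x = i
      · simp [hx, hi]
      · have := h2 x
        simp only [Finset.mem_erase, ne_eq, hx, not_false_iff, true_and] at this
        simp [this, hx]
    · have hiW : ∀ W ∈ Q, i ∉ W := fun W hW hiW =>
        Finset.notMem_erase i V ((h2 i).2 ⟨W, hW, hiW⟩)
      intro W hW W' hW' x hx hx'
      rw [Finset.mem_insert] at hW hW'
      rcases hW with rfl | hW <;> rcases hW' with rfl | hW'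
      · rfl
      · rw [Finset.mem_singleton] at hx
        exact absurd (hx ▸ hx') (hiW _ hW')
      · rw [Finset.mem_singleton] at hx'
        exact absurd (hx' ▸ hx) (hiW _ hW)
      · exact h3 W hW W' hW' x hx hx'
  · intro Q hQ
    obtain ⟨hQ, hiQ⟩ := Finset.mem_filter.1 hQ
    obtain ⟨h1, h2, h3⟩ := mem_partitions.1 hQ
    rw [mem_partitions]
    refine ⟨fun h => h1 (Finset.mem_of_mem_erase h), ?_, fun W hW W' hW' =>
      h3 W (Finset.mem_of_mem_erase hW) W' (Finset.mem_of_mem_erase hW')⟩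
    intro x
    simp only [Finset.mem_erase, h2 x]
    constructor
    · rintro ⟨hx, W, hW, hxW⟩
      refine ⟨W, ⟨?_, hW⟩, hxW⟩
      rintro rfl
      exact hx (Finset.mem_singleton.1 hxW)
    · rintro ⟨W, ⟨hne, hW⟩, hxW⟩
      refine ⟨?_, W, hW, hxW⟩
      rintro rfl
      exact hne (h3 W hW _ hiQ x hxW (Finset.mem_singleton_self x))
  · intro Q hQ
    exact Finset.erase_insert (hnot Q hQ)
  · intro Q hQ
    exact Finset.insert_erase (Finset.mem_filter.1 hQ).2
  · intro Q hQ
    simp only [hNC Q hQ, Finset.prod_insert (hnot Q hQ), mul_ite, mul_zero]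

/-- Free cumulants are small if the moments almost factorize at the index `i`. -/
theorem exists_norm_freeCumulantOn_le_mul (𝔘 : Type*) [CStarAlgebra 𝔘] (i : Fin n)
    (V : Finset (Fin n)) (hi : i ∈ V) (hV : V ≠ {i}) :
    ∃ C : ℝ, 0 ≤ C ∧ ∀ (ω : 𝔘 →L[ℂ] ℂ) (A : Fin n → 𝔘) (b : Fin n → ℝ) (ε : ℝ),
      0 ≤ ε → (∀ j, 0 ≤ b j) → (∀ W, ‖moment ω A W‖ ≤ ∏ j ∈ W, b j) →
      (∀ W, i ∈ W → ‖moment ω A W - moment ω A (W.erase i) * moment ω A {i}‖ ≤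
        ε * ∏ j ∈ W, b j) →
      ‖freeCumulantOn ω A V‖ ≤ C * ε * ∏ j ∈ V, b j := by
  classical
  induction hk : V.card using Nat.strong_induction_on generalizing V with
  | _ k ih =>
    subst hk
    have ih' : ∀ W : Finset (Fin n), W.card < V.card → i ∈ W → W ≠ {i} → ∃ C : ℝ, 0 ≤ C ∧
        ∀ (ω : 𝔘 →L[ℂ] ℂ) (A : Fin n → 𝔘) (b : Fin n → ℝ) (ε : ℝ),
        0 ≤ ε → (∀ j, 0 ≤ b j) → (∀ W, ‖moment ω A W‖ ≤ ∏ j ∈ W, b j) →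
        (∀ W, i ∈ W → ‖moment ω A W - moment ω A (W.erase i) * moment ω A {i}‖ ≤
          ε * ∏ j ∈ W, b j) →
        ‖freeCumulantOn ω A W‖ ≤ C * ε * ∏ j ∈ W, b j :=
      fun W hW hiW hne => ih _ hW W hiW hne rfl
    choose! C hC0 hC using ih'
    choose B hB0 hB using fun W : Finset (Fin n) => exists_norm_freeCumulantOn_le 𝔘 W
    -- The `1` accounts for the factorization defect of the moment of `V`. In each other partition
    -- the block of `i` gets the inductive constant, which comes with `ε`, and the remaining blocks
    -- get the plain bound.
    refine ⟨1 + ∑ Q ∈ partitions V, |∏ W ∈ Q, if i ∈ W then C W else B W|, by positivity, ?_⟩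
    intro ω A b ε hε hb hm hf
    have hbV : 0 ≤ ∏ j ∈ V, b j := Finset.prod_nonneg fun j _ => hb j
    have hVne : (V.erase i).Nonempty := by
      rw [Finset.nonempty_iff_ne_empty, ne_eq, Finset.erase_eq_empty_iff]
      rintro (h | h)
      · rw [h] at hi
        exact absurd hi (Finset.notMem_empty i)
      · exact hV h
    -- The partitions with block `{i}` add up, by the moment formula on `V.erase i`, to the product
    -- that is subtracted from the moment of `V`.
    have hsplit : freeCumulantOn ω A V =
        (moment ω A V - moment ω A (V.erase i) * moment ω A {i}) -
          ∑ Q ∈ partitions V with {i} ∉ Q,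
            if NonCrossingFamily Q ∧ Q ≠ {V} then ∏ W ∈ Q, freeCumulantOn ω A W else 0 := by
      rw [freeCumulantOn_eq_sub_sum, ← Finset.sum_filter_add_sum_filter_not _ ({i} ∈ ·),
        sum_partitions_singleton_mem _ hi hV, ← moment_eq_sum_partitions ω A _ hVne,
        freeCumulantOn_singleton]
      ring
    have hsum : ‖∑ Q ∈ partitions V with {i} ∉ Q,
        if NonCrossingFamily Q ∧ Q ≠ {V} then ∏ W ∈ Q, freeCumulantOn ω A W else 0‖ ≤
        ∑ Q ∈ partitions V, |∏ W ∈ Q, if i ∈ W then C W else B W| * ε * ∏ j ∈ V, b j := by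
      refine (norm_sum_le_of_le _ fun Q hQ => ?_).trans
        (Finset.sum_le_sum_of_subset_of_nonneg (Finset.filter_subset _ _)
          fun Q _ _ => by positivity)
      obtain ⟨hQ, hiQ⟩ := Finset.mem_filter.1 hQ
      split_ifs with h
      · calc ‖∏ W ∈ Q, freeCumulantOn ω A W‖
            ≤ ∏ W ∈ Q, ((if i ∈ W then C W else B W) * (if i ∈ W then ε else 1) *
                ∏ j ∈ W, b j) := by
              rw [norm_prod]
              refine Finset.prod_le_prod (fun _ _ => norm_nonneg _) fun W hW => ?_
              split_ifs with hiW
              · exact hC W (card_lt_of_mem_partitions hQ h.2 hW) hiW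
                  (fun h => hiQ (h ▸ hW)) ω A b ε hε hb hm hf
              · rw [mul_one]
                exact hB W ω A b hb hm
          _ = (∏ W ∈ Q, if i ∈ W then C W else B W) * ε * ∏ j ∈ V, b j := by
              obtain ⟨π, -, rfl⟩ := Finset.mem_image.1 hQ
              rw [Finset.prod_mul_distrib, Finset.prod_mul_distrib, prod_partition_prod,
                prod_ite_mem_parts π hi]
          _ ≤ _ := by
              gcongr
              exact le_abs_self _
      · rw [norm_zero]
        positivity
    rw [hsplit]
    refine (norm_sub_le_of_le (hf V hi) hsum).trans (le_of_eq ?_)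
    simp only [← Finset.sum_mul]
    ring

end Cumulants
end QSL
namespace QSL

/-! ### Norm and normalization of states -/

section States

variable {𝔘 : Type*} [CStarAlgebra 𝔘] {ω : 𝔘 →L[ℂ] ℂ}

theorem IsState.norm_apply_le (hω : IsState ω) (A : 𝔘) : ‖ω A‖ ≤ ‖A‖ := by
  simpa [hω.2] using ω.le_opNorm A

/-- Polarization: the values of `ω` at `X * star X` are real for `X = 1`, `A` and `i A + 1`, and the
imaginary part of the last is `Re ω(A) - Re ω(star A)` up to the first two. -/
theorem IsState.re_star (hω : IsState ω) (A : 𝔘) : (ω (star A)).re = (ω A).re := by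
  have h1 := (hω.1 1).2
  have h2 := (hω.1 A).2
  have h3 := (hω.1 (Complex.I • A + 1)).2
  simp only [star_add, star_one, star_smul, add_mul, mul_add, mul_one, one_mul, map_add,
    smul_mul_assoc, mul_smul_comm, map_smul, smul_eq_mul, Complex.add_im] at h1 h2 h3
  simp [h2] at h1 h2 h3
  linarith

/-- States are normalized. -/
theorem IsState.apply_one [Nontrivial 𝔘] (hω : IsState ω) : ω 1 = 1 := by
  obtain ⟨h0, him⟩ := hω.1 1
  rw [star_one, mul_one] at h0 him
  have hle : (ω 1).re ≤ 1 := by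
    refine (Complex.re_le_norm _).trans ((hω.norm_apply_le 1).trans ?_)
    rw [norm_one]
  -- For a unit vector `B`, rotated so that `ω B = |ω A|`, positivity at `B - 1` gives `2 |ω A| ≤
  -- ω(B star B) + ω 1 ≤ 1 + ω 1`. As `‖ω‖ = 1`, this forces `ω 1 ≥ 1`.
  have hbound : ‖ω‖ ≤ (1 + (ω 1).re) / 2 := by
    refine ContinuousLinearMap.opNorm_le_of_unit_norm (𝕜 := ℂ) (by linarith) fun A hA => ?_
    obtain ⟨c, hc, hcA⟩ := RCLike.exists_norm_mul_eq_self (ω A)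
    have hc0 : c ≠ 0 := by
      rintro rfl
      simp at hc
    set B := c⁻¹ • A with hB
    have hωB : (ω B).re = ‖ω A‖ := by
      have : ω B = (‖ω A‖ : ℂ) := by
        rw [hB, map_smul, smul_eq_mul, inv_mul_eq_div, div_eq_iff hc0, mul_comm]
        exact hcA.symm
      rw [this, Complex.ofReal_re]
    have hBn : ‖B‖ = 1 := by
      rw [hB, norm_smul, norm_inv, hc, hA, inv_one, one_mul]
    have h1 := (hω.1 (B - 1)).1
    have h2 := hω.re_star B
    have h3 : (ω (B * star B)).re ≤ 1 := by
      refine (Complex.re_le_norm _).trans ((hω.norm_apply_le _).trans ?_)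
      rw [CStarRing.norm_self_mul_star, hBn, one_mul]
    simp only [star_sub, star_one, sub_mul, mul_sub, mul_one, one_mul, map_sub,
      Complex.sub_re] at h1
    linarith
  rw [hω.2] at hbound
  apply Complex.ext
  · rw [Complex.one_re]
    linarith
  · rw [him, Complex.one_im]

end States

/-! ### Perturbation of ordered products -/

section Lists

variable {ι 𝔘 : Type*} [CStarAlgebra 𝔘] [Nontrivial 𝔘] {X X' : ι → 𝔘} {b : ι → ℝ} {δ : ℝ}

theorem norm_list_prod_le (hX : ∀ j, ‖X j‖ ≤ b j) (l : List ι) :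
    ‖(l.map X).prod‖ ≤ (l.map b).prod := by
  induction l with
  | nil => simp
  | cons j l ih =>
    simp only [List.map_cons, List.prod_cons]
    exact (norm_mul_le _ _).trans
      (mul_le_mul (hX j) ih (norm_nonneg _) ((norm_nonneg _).trans (hX j)))

/-- Telescoping: the factors are replaced one at a time, and each replacement costs a relative error
`δ`. -/
theorem norm_list_prod_sub_le (hX : ∀ j, ‖X j‖ ≤ b j) (hX' : ∀ j, ‖X' j‖ ≤ b j)
    (hδ : ∀ j, ‖X j - X' j‖ ≤ δ * b j) (l : List ι) :
    ‖(l.map X).prod - (l.map X').prod‖ ≤ l.length * δ * (l.map b).prod := by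
  induction l with
  | nil => simp
  | cons j l ih =>
    simp only [List.map_cons, List.prod_cons, List.length_cons]
    have hj : 0 ≤ b j := (norm_nonneg _).trans (hX j)
    calc ‖X j * (l.map X).prod - X' j * (l.map X').prod‖
        = ‖X j * ((l.map X).prod - (l.map X').prod) + (X j - X' j) * (l.map X').prod‖ := by
          congr 1
          noncomm_ring
      _ ≤ b j * (l.length * δ * (l.map b).prod) + δ * b j * (l.map b).prod :=
          norm_add_le_of_le
            ((norm_mul_le _ _).trans (mul_le_mul (hX j) ih (norm_nonneg _) hj))
            ((norm_mul_le _ _).trans (mul_le_mul (hδ j) (norm_list_prod_le hX' l)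
              (norm_nonneg _) ((norm_nonneg _).trans (hδ j))))
      _ = _ := by
          push_cast
          ring

end Lists

/-! ### Factorization of moments by local approximation -/

section Moments

variable {n : ℕ} {𝔘 : Type*} [CStarAlgebra 𝔘]

theorem prod_map_sort {M : Type*} [CommMonoid M] (W : Finset (Fin n)) (b : Fin n → M) :
    ((W.sort (· ≤ ·)).map b).prod = ∏ j ∈ W, b j := by
  rw [← List.prod_toFinset b (W.sort_nodup _), Finset.sort_toFinset]

/-- Deleting `i` from the increasing list of `W` leaves the increasing list of `W.erase i`. So the
two moments have the form `ω (A B C)` and `ω (A C)` required by three-element clustering. -/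
theorem exists_sort_eq_append {W : Finset (Fin n)} {i : Fin n} (hi : i ∈ W) :
    ∃ l₁ l₂ : List (Fin n), W.sort (· ≤ ·) = l₁ ++ i :: l₂ ∧
      (W.erase i).sort (· ≤ ·) = l₁ ++ l₂ ∧ i ∉ l₁ ∧ i ∉ l₂ := by
  obtain ⟨l₁, l₂, h⟩ := List.append_of_mem ((Finset.mem_sort (α := Fin n) (· ≤ ·)).2 hi)
  have hnd : (l₁ ++ i :: l₂).Nodup := h ▸ W.sort_nodup _
  have hsorted : (l₁ ++ i :: l₂).Pairwise (· ≤ ·) := h ▸ W.pairwise_sort _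
  have hsub : (l₁ ++ l₂).Sublist (l₁ ++ i :: l₂) :=
    List.Sublist.append_left (List.sublist_cons_self i l₂) l₁
  obtain ⟨hi', -⟩ : i ∉ l₁ ++ l₂ ∧ (l₁ ++ l₂).Nodup := List.nodup_cons.1 (List.nodup_middle.1 hnd)
  rw [List.mem_append, not_or] at hi'
  refine ⟨l₁, l₂, h, ?_, hi'.1, hi'.2⟩
  have hset : (l₁ ++ l₂).toFinset = W.erase i := by
    have hW : W = (l₁ ++ i :: l₂).toFinset := by rw [← h, Finset.sort_toFinset]
    ext x
    simp only [hW, List.mem_toFinset, Finset.mem_erase, List.mem_append, List.mem_cons]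
    constructor
    · rintro (hx | hx)
      · exact ⟨fun h => hi'.1 (h ▸ hx), Or.inl hx⟩
      · exact ⟨fun h => hi'.2 (h ▸ hx), Or.inr (Or.inr hx)⟩
    · rintro ⟨hne, hx | hx | hx⟩
      · exact Or.inl hx
      · exact absurd hx hne
      · exact Or.inr hx
  rw [← hset]
  exact (List.toFinset_sort (· ≤ ·) (hsub.nodup hnd)).2 (hsorted.sublist hsub)

/-- If approximants cluster, then the moments almost factorize. -/
theorem norm_moment_sub_le [Nontrivial 𝔘] {ω : 𝔘 →L[ℂ] ℂ} (hω : IsState ω) {X X' : Fin n → 𝔘}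
    {b : Fin n → ℝ} {δ η : ℝ} {i : Fin n} (hδ0 : 0 ≤ δ) (hX : ∀ j, ‖X j‖ ≤ b j)
    (hX' : ∀ j, ‖X' j‖ ≤ b j) (hδ : ∀ j, ‖X j - X' j‖ ≤ δ * b j)
    (hη : ∀ l₁ l₂ : List (Fin n), i ∉ l₁ → i ∉ l₂ →
      ‖ω ((l₁.map X').prod * X' i * (l₂.map X').prod) -
          ω ((l₁.map X').prod * (l₂.map X').prod) * ω (X' i)‖ ≤
        η * (‖(l₁.map X').prod‖ * ‖X' i‖ * ‖(l₂.map X').prod‖)) (hη0 : 0 ≤ η)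
    {W : Finset (Fin n)} (hi : i ∈ W) :
    ‖moment ω X W - moment ω X (W.erase i) * moment ω X {i}‖ ≤
      (η + 2 * n * δ) * ∏ j ∈ W, b j := by
  have hb : ∀ j, 0 ≤ b j := fun j => (norm_nonneg _).trans (hX j)
  obtain ⟨l₁, l₂, h1, h2, hi₁, hi₂⟩ := exists_sort_eq_append hi
  have hlen : (l₁ ++ i :: l₂).length ≤ n := by
    rw [← h1, Finset.length_sort]
    exact (Finset.card_le_univ W).trans_eq (Fintype.card_fin n)
  have hbW : ∏ j ∈ W, b j = (l₁.map b).prod * b i * (l₂.map b).prod := by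
    rw [← prod_map_sort, h1]
    simp [mul_assoc]
  have hbW' : ((l₁ ++ l₂).map b).prod * b i = ∏ j ∈ W, b j := by
    rw [hbW]
    simp only [List.map_append, List.prod_append]
    ring
  have hbW0 : 0 ≤ ∏ j ∈ W, b j := Finset.prod_nonneg fun j _ => hb j
  have hm : moment ω X {i} = ω (X i) := by simp [moment]
  -- Three errors add up: passing to the approximants in the full moment (`e1`) and in the product
  -- of moments (`e2`), each over at most `n` factors, and the clustering error of the approximants
  -- (`e3`).
  have e1 : ‖ω ((l₁ ++ i :: l₂).map X).prod - ω ((l₁ ++ i :: l₂).map X').prod‖ ≤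
      n * δ * ∏ j ∈ W, b j := by
    rw [← map_sub]
    refine (hω.norm_apply_le _).trans ((norm_list_prod_sub_le hX hX' hδ _).trans ?_)
    rw [← h1, prod_map_sort, h1]
    have : ((l₁ ++ i :: l₂).length : ℝ) ≤ n := by exact_mod_cast hlen
    gcongr
  have e2 : ‖ω ((l₁ ++ l₂).map X).prod * ω (X i) - ω ((l₁ ++ l₂).map X').prod * ω (X' i)‖ ≤
      n * δ * ∏ j ∈ W, b j := by
    have hP : ‖ω ((l₁ ++ l₂).map X).prod - ω ((l₁ ++ l₂).map X').prod‖ ≤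
        (l₁ ++ l₂).length * δ * ((l₁ ++ l₂).map b).prod := by
      rw [← map_sub]
      exact (hω.norm_apply_le _).trans (norm_list_prod_sub_le hX hX' hδ _)
    have hP' : ‖ω ((l₁ ++ l₂).map X').prod‖ ≤ ((l₁ ++ l₂).map b).prod :=
      (hω.norm_apply_le _).trans (norm_list_prod_le hX' _)
    have hXi : ‖ω (X i)‖ ≤ b i := (hω.norm_apply_le _).trans (hX i)
    have hXi' : ‖ω (X i) - ω (X' i)‖ ≤ δ * b i := by
      rw [← map_sub]
      exact (hω.norm_apply_le _).trans (hδ i)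
    calc _ = ‖(ω ((l₁ ++ l₂).map X).prod - ω ((l₁ ++ l₂).map X').prod) * ω (X i) +
          ω ((l₁ ++ l₂).map X').prod * (ω (X i) - ω (X' i))‖ := by
          congr 1
          ring
      _ ≤ (l₁ ++ l₂).length * δ * ((l₁ ++ l₂).map b).prod * b i +
          ((l₁ ++ l₂).map b).prod * (δ * b i) := by
          refine norm_add_le_of_le ?_ ?_
          · rw [norm_mul]
            exact mul_le_mul hP hXi (norm_nonneg _) ((norm_nonneg _).trans hP)
          · rw [norm_mul]
            exact mul_le_mul hP' hXi' (norm_nonneg _) ((norm_nonneg _).trans hP')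
      _ = ((l₁ ++ l₂).length + 1 : ℝ) * δ * (((l₁ ++ l₂).map b).prod * b i) := by ring
      _ ≤ _ := by
          rw [hbW']
          have : ((l₁ ++ l₂).length + 1 : ℝ) ≤ n := by
            simp only [List.length_append, List.length_cons] at hlen ⊢
            exact_mod_cast hlen
          gcongr
  have e3 : ‖ω ((l₁ ++ i :: l₂).map X').prod - ω ((l₁ ++ l₂).map X').prod * ω (X' i)‖ ≤
      η * ∏ j ∈ W, b j := by
    simp only [List.map_append, List.map_cons, List.prod_append, List.prod_cons]
    rw [← mul_assoc]
    refine (hη l₁ l₂ hi₁ hi₂).trans (mul_le_mul_of_nonneg_left ?_ hη0)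
    rw [hbW]
    have h3 := norm_list_prod_le hX' l₁
    have h4 := norm_list_prod_le hX' l₂
    have h5 := (norm_nonneg _).trans h3
    have h6 := hX' i
    have h7 := hb i
    gcongr
  rw [hm, moment, moment, h1, h2]
  calc _ = ‖(ω ((l₁ ++ i :: l₂).map X).prod - ω ((l₁ ++ i :: l₂).map X').prod) +
        (ω ((l₁ ++ i :: l₂).map X').prod - ω ((l₁ ++ l₂).map X').prod * ω (X' i)) -
        (ω ((l₁ ++ l₂).map X).prod * ω (X i) - ω ((l₁ ++ l₂).map X').prod * ω (X' i))‖ := by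
        congr 1
        ring
    _ ≤ n * δ * ∏ j ∈ W, b j + η * ∏ j ∈ W, b j + n * δ * ∏ j ∈ W, b j :=
        norm_sub_le_of_le (norm_add_le_of_le e1 e3) e2
    _ = _ := by ring

end Moments

/-! ### Clustering of local observables and localisation of the evolution -/

section Clustering

/-- A polynomial of degree at most `r` grows at most like the `r`-th power. -/
theorem abs_eval_le {σ : Type*} [Fintype σ] (P : MvPolynomial σ ℝ) {r : ℕ}
    (hr : P.totalDegree ≤ r) {x : σ → ℝ} {M : ℝ} (hM : 1 ≤ M) (h0 : ∀ i, 0 ≤ x i)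
    (hx : ∀ i, x i ≤ M) :
    |MvPolynomial.eval x P| ≤ (∑ m ∈ P.support, |P.coeff m|) * M ^ r := by
  rw [MvPolynomial.eval_eq', Finset.sum_mul]
  refine (Finset.abs_sum_le_sum_abs _ _).trans (Finset.sum_le_sum fun m hm => ?_)
  rw [abs_mul, abs_of_nonneg (Finset.prod_nonneg fun i _ => pow_nonneg (h0 i) _)]
  refine mul_le_mul_of_nonneg_left ?_ (abs_nonneg _)
  have hdeg : ∑ i, m i ≤ r := by
    have := MvPolynomial.le_totalDegree hm
    rw [Finsupp.sum_fintype _ _ (fun _ => rfl)] at this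
    exact this.trans hr
  calc ∏ i, x i ^ m i ≤ ∏ i, M ^ m i :=
        Finset.prod_le_prod (fun i _ => pow_nonneg (h0 i) _)
          fun i _ => pow_le_pow_left₀ (h0 i) (hx i) _
    _ = M ^ ∑ i, m i := Finset.prod_pow_eq_pow_sum _ _ _
    _ ≤ M ^ r := pow_le_pow_right₀ hM hdeg

variable {D : ℕ} {𝔘 : Type*} [CStarAlgebra 𝔘] (S : LatticeSystem D 𝔘)

/-- Clustering at time zero, in terms of regions instead of supports. -/
theorem ThreeElementClustering.norm_sub_le {S : LatticeSystem D 𝔘} {ω : 𝔘 →L[ℂ] ℂ}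
    {vLR p : ℝ} {P : MvPolynomial (Fin 2) ℝ} {u : ℝ → ℝ}
    (hcl : ThreeElementClustering S ω vLR p P u) (hω : IsState ω) {v : ℝ} (hv : vLR < v)
    (hv0 : 0 < v) (hu : 0 < u v) {r : ℕ} (hr : P.totalDegree ≤ r) (hp : 0 ≤ p)
    {Y T : Finset (Lattice D)} {d : ℕ} (hd : ∀ y ∈ Y, ∀ y' ∈ T, d ≤ latDist y y')
    {M : ℝ} (hM : 1 ≤ M) (hY : (Y.card : ℝ) ≤ M) (hT : (T.card : ℝ) ≤ M)
    {A B C : 𝔘} (hA : A ∈ S.region T) (hB : B ∈ S.region Y) (hC : C ∈ S.region T) :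
    ‖ω (A * B * C) - ω (A * C) * ω B‖ ≤
      u v * ((∑ m ∈ P.support, |P.coeff m|) * M ^ r) / (1 + d : ℝ) ^ p * (‖A‖ * ‖B‖ * ‖C‖) := by
  have := S.nontrivial
  have hcoef : 0 ≤ ∑ m ∈ P.support, |P.coeff m| := Finset.sum_nonneg fun _ _ => abs_nonneg _
  have hM0 : 0 ≤ M := zero_le_one.trans hM
  have hnn : 0 ≤ u v * ((∑ m ∈ P.support, |P.coeff m|) * M ^ r) / (1 + d : ℝ) ^ p *
      (‖A‖ * ‖B‖ * ‖C‖) := by positivity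
  -- The clustering hypothesis says nothing about empty supports, but such observables are scalars
  -- and factor exactly, as `ω 1 = 1`.
  rcases (S.supp B).eq_empty_or_nonempty with hBe | hBne
  · obtain ⟨c, rfl⟩ := S.exists_algebraMap_of_supp_eq_empty ⟨_, hB⟩ hBe
    rw [Algebra.algebraMap_eq_smul_one, mul_smul_comm, mul_one, smul_mul_assoc, map_smul, map_smul,
      hω.apply_one, smul_eq_mul, smul_eq_mul, mul_one, mul_comm, sub_self, norm_zero]
    rwa [Algebra.algebraMap_eq_smul_one] at hnn
  rcases (S.supp A ∪ S.supp C).eq_empty_or_nonempty with hACe | hACne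
  · obtain ⟨hAe, hCe⟩ := Set.union_empty_iff.1 hACe
    obtain ⟨a, rfl⟩ := S.exists_algebraMap_of_supp_eq_empty ⟨_, hA⟩ hAe
    obtain ⟨c, rfl⟩ := S.exists_algebraMap_of_supp_eq_empty ⟨_, hC⟩ hCe
    have : ω (algebraMap ℂ 𝔘 a * B * algebraMap ℂ 𝔘 c) -
        ω (algebraMap ℂ 𝔘 a * algebraMap ℂ 𝔘 c) * ω B = 0 := by
      simp only [Algebra.algebraMap_eq_smul_one, mul_smul_comm, mul_one, smul_mul_assoc, one_mul,
        map_smul, hω.apply_one, smul_eq_mul]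
      ring
    rw [this, norm_zero]
    exact hnn
  have hBsub := S.supp_subset hB
  have hACsub : S.supp A ∪ S.supp C ⊆ T := Set.union_subset (S.supp_subset hA) (S.supp_subset hC)
  -- Translation and time are already contained in the approximants, so clustering is used at the
  -- origin and at time zero only.
  have h := hcl v hv A B C ⟨_, hA⟩ ⟨_, hB⟩ ⟨_, hC⟩ hBne hACne 0 0 (by rw [abs_zero]; positivity)
  simp only [LatticeSystem.translate, S.τ_zero, S.ι_zero] at h
  refine h.trans ?_
  have hdist : (d : ℝ) ≤ setDist (S.supp B) (S.supp A ∪ S.supp C) := by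
    exact_mod_cast le_setDist hBne hACne fun y hy y' hy' => hd y (hBsub hy) y' (hACsub hy')
  have hev : MvPolynomial.eval ![((S.supp B).ncard : ℝ), ((S.supp A ∪ S.supp C).ncard : ℝ)] P ≤
      (∑ m ∈ P.support, |P.coeff m|) * M ^ r := by
    refine (le_abs_self _).trans (abs_eval_le P hr hM ?_ ?_)
    · intro i
      fin_cases i <;> simp
    · have h1 : ((S.supp B).ncard : ℝ) ≤ M := by
        refine le_trans ?_ hY
        exact_mod_cast S.ncard_supp_le hB
      have h2 : ((S.supp A ∪ S.supp C).ncard : ℝ) ≤ M := by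
        refine le_trans ?_ hT
        rw [← Set.ncard_coe_finset]
        exact_mod_cast Set.ncard_le_ncard hACsub T.finite_toSet
      intro i
      fin_cases i
      · exact h1
      · exact h2
  calc _ ≤ u v * ‖A‖ * ‖B‖ * ‖C‖ * ((∑ m ∈ P.support, |P.coeff m|) * M ^ r) /
        (1 + d : ℝ) ^ p := by gcongr
    _ = _ := by ring

/-- Time-evolved observables are approximated by observables of a thickened support. -/
theorem exists_mem_region_thickening {v L l : ℝ} (hL : 0 < L) (hl : 0 < l)
    (hLR : ∀ (A B : 𝔘) (t : ℝ), S.IsLocal A → S.IsLocal B →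
      ‖S.τ t A * B - B * S.τ t A‖ ≤
        L * ‖A‖ * ‖B‖ * (min (S.supp A).ncard (S.supp B).ncard : ℕ) *
          Real.exp (-l * (setDist (S.supp A) (S.supp B) - v * |t|)))
    {A : 𝔘} {X : Finset (Lattice D)} (hA : S.IsLocal A) (hAX : (X : Set (Lattice D)) = S.supp A)
    (hX : X.Nonempty) (t : ℝ) (k : ℕ) {c ε : ℝ} (hc : v * |t| + c ≤ k + 1) (hε : 0 < ε) :
    ∃ B ∈ S.region (thickening k X),
      ‖B - S.τ t A‖ ≤ L * ‖A‖ * X.card * Real.exp (-l * c) + ε := by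
  refine S.exists_mem_region_norm_sub_le hε fun U hU hU1 hdisj => ?_
  refine (hLR A U t hA hU).trans ?_
  -- The distance to an empty support has the junk value `0`, but the factor `min` vanishes.
  rcases (S.supp U).eq_empty_or_nonempty with h0 | hne
  · rw [h0, Set.ncard_empty, Nat.min_zero, Nat.cast_zero, mul_zero, zero_mul]
    positivity
  have hdist : (k + 1 : ℝ) ≤ setDist (S.supp A) (S.supp U) := by
    have : k + 1 ≤ setDist (S.supp A) (S.supp U) := by
      refine le_setDist (by rw [← hAX]; exact_mod_cast hX) hne fun x hx y hy => ?_
      -- A lattice point outside the `k`-neighbourhood is at distance at least `k + 1`.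
      by_contra hlt
      refine Set.disjoint_left.1 hdisj hy (Finset.mem_coe.2 (mem_thickening.2 ⟨x, ?_, by omega⟩))
      rwa [← hAX] at hx
    exact_mod_cast this
  have hcard : ((min (S.supp A).ncard (S.supp U).ncard : ℕ) : ℝ) ≤ X.card := by
    rw [← hAX, Set.ncard_coe_finset]
    exact_mod_cast min_le_left _ _
  have hexp : Real.exp (-l * (setDist (S.supp A) (S.supp U) - v * |t|)) ≤
      Real.exp (-l * c) := Real.exp_le_exp.2 (by nlinarith)
  calc _ ≤ L * ‖A‖ * 1 * X.card * Real.exp (-l * c) := by gcongr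
    _ = _ := by ring

/-- Exponential decay beats any power: `(1 + z)^q e^{-c (1 + z)}` tends to zero and is therefore
bounded. -/
theorem exists_exp_le_div_rpow {c : ℝ} (hc : 0 < c) (q : ℝ) :
    ∃ E : ℝ, 0 ≤ E ∧ ∀ z : ℕ, Real.exp (-c * z) ≤ E / (1 + z : ℝ) ^ q := by
  have h1 : Tendsto (fun z : ℕ => (1 + z : ℝ) ^ q * Real.exp (-c * (1 + z))) atTop (𝓝 0) := by
    refine (tendsto_rpow_mul_exp_neg_mul_atTop_nhds_zero q c hc).comp ?_
    exact tendsto_atTop_add_const_left _ _ tendsto_natCast_atTop_atTop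
  obtain ⟨E, hE⟩ := h1.bddAbove_range
  have hE' : ∀ z : ℕ, (1 + z : ℝ) ^ q * Real.exp (-c * (1 + z)) ≤ E := fun z => hE ⟨z, rfl⟩
  refine ⟨E * Real.exp c, mul_nonneg ((by positivity : (0 : ℝ) ≤ _).trans (hE' 0))
    (Real.exp_nonneg _), fun z => ?_⟩
  rw [le_div_iff₀ (by positivity)]
  calc Real.exp (-c * z) * (1 + z : ℝ) ^ q
      = (1 + z : ℝ) ^ q * Real.exp (-c * (1 + z)) * Real.exp c := by
        rw [mul_assoc, ← Real.exp_add, mul_comm]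
        congr 2
        ring
    _ ≤ _ := mul_le_mul_of_nonneg_right (hE' z) (Real.exp_nonneg _)

/-- The supremum over finitely many indices is attained; the maximising index is the isolated one.
-/
theorem LatticeSystem.exists_separation_le {n : ℕ} (hn : 0 < n) (A : Fin n → 𝔘)
    (x : Fin n → Lattice D) :
    ∃ i, ∀ j, j ≠ i → S.separation A x ≤
      setDist (S.supp (S.ι (x i) (A i))) (S.supp (S.ι (x j) (A j))) := by
  have : Nonempty (Fin n) := ⟨⟨0, hn⟩⟩
  obtain ⟨i, hi⟩ := exists_eq_ciSup_of_finite (f := fun i : Fin n =>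
    ⨅ j : {j : Fin n // j ≠ i},
      setDist (S.supp (S.ι (x i) (A i))) (S.supp (S.ι (x j.1) (A j.1))))
  refine ⟨i, fun j hj => ?_⟩
  rw [LatticeSystem.separation, ← hi]
  exact ciInf_le (OrderBot.bddBelow _) (⟨j, hj⟩ : {j : Fin n // j ≠ i})

end Clustering
end QSL
namespace QSL

/-! ### Factorization for space-time translates and the final estimate -/

variable {D : ℕ} {𝔘 : Type*} [CStarAlgebra 𝔘]

/-- Space-time translated observables have local approximants whose regions keep a third of the
separation. -/
theorem exists_local_approximants (S : LatticeSystem D 𝔘) {v v₀ L l : ℝ} (hv₀ : 0 < v₀)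
    (hL : 0 < L) (hl : 0 < l)
    (hLR : ∀ (A B : 𝔘) (t : ℝ), S.IsLocal A → S.IsLocal B →
      ‖S.τ t A * B - B * S.τ t A‖ ≤
        L * ‖A‖ * ‖B‖ * (min (S.supp A).ncard (S.supp B).ncard : ℕ) *
          Real.exp (-l * (setDist (S.supp A) (S.supp B) - v₀ * |t|)))
    (hv : 6 * v₀ < v) {A : 𝔘} (hA : S.IsLocal A) (hne : (S.supp A).Nonempty) (x : Lattice D)
    {z : ℕ} {t s : ℝ} (ht : |t| ≤ v⁻¹ * z - 1) (hs : ((S.supp A).ncard : ℝ) ≤ s) :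
    ∃ (X : Finset (Lattice D)) (B : 𝔘), (X : Set (Lattice D)) = S.supp (S.ι x A) ∧
      ((thickening (z / 3) X).card : ℝ) ≤ (S.supp A).ncard * (1 + z : ℝ) ^ D ∧
      B ∈ S.region (thickening (z / 3) X) ∧ ‖B‖ ≤ (L * s + 2) * ‖A‖ ∧
      ‖S.translate A x t - B‖ ≤ Real.exp (-(l / 6) * z) * ((L * s + 2) * ‖A‖) := by
  have hloc := S.isLocal_ι hA x
  obtain ⟨X, hX, -⟩ := hloc.exists_region_eq_supp
  have hcard : X.card = (S.supp A).ncard := by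
    rw [← S.ncard_supp_ι hA x, ← hX, Set.ncard_coe_finset]
  have hXne : X.Nonempty := by
    rw [← Finset.coe_nonempty, hX, S.supp_ι hA]
    exact hne.image _
  -- The zero observable has empty support, so `A ≠ 0`; this makes the `ε` chosen below positive.
  have hA0 : 0 < ‖A‖ := by
    rw [norm_pos_iff]
    rintro rfl
    obtain ⟨y, hy⟩ := hne
    exact Finset.notMem_empty y (hy ∅ (zero_mem _))
  have hz3 : (z : ℝ) / 3 ≤ (z / 3 : ℕ) + 1 := by
    have h : z ≤ 3 * (z / 3 + 1) := by omega
    have h' : (z : ℝ) ≤ 3 * ((z / 3 : ℕ) + 1) := by exact_mod_cast h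
    linarith
  have hvt : v₀ * |t| ≤ z / 6 := by
    have hvpos : 0 < v := by linarith
    have h1 : v * |t| ≤ z := by
      have h2 := mul_le_mul_of_nonneg_left ht hvpos.le
      rw [mul_sub, mul_inv_cancel_left₀ hvpos.ne', mul_one] at h2
      linarith
    have h3 := mul_le_mul_of_nonneg_right hv.le (abs_nonneg t)
    linarith
  -- Of the radius `z/3`, the light cone uses at most `z/6`, and the other `z/6` is the slack that
  -- yields the exponential error. Rounding down is covered by the `k + 1` in the localisation
  -- bound.
  obtain ⟨B, hB, hBA⟩ := exists_mem_region_thickening S hL hl hLR hloc hX hXne t (z / 3)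
    (c := z / 6) (ε := Real.exp (-(l / 6) * z) * ‖A‖) (by linarith) (by positivity)
  have htr : S.translate A x t = S.τ t (S.ι x A) := (S.τ_ι t x A).symm
  rw [← htr, S.norm_ι, hcard] at hBA
  have hBA' : ‖B - S.translate A x t‖ ≤
      Real.exp (-(l / 6) * z) * ((L * s + 1) * ‖A‖) := by
    refine hBA.trans ?_
    have he : -l * (z / 6 : ℝ) = -(l / 6) * z := by ring
    rw [he]
    calc _ = Real.exp (-(l / 6) * z) * ((L * (S.supp A).ncard + 1) * ‖A‖) := by ring
      _ ≤ _ := by gcongr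
  have hs0 : 0 ≤ s := (Nat.cast_nonneg _).trans hs
  have hexp1 : Real.exp (-(l / 6) * z) ≤ 1 := by
    rw [Real.exp_le_one_iff]
    have : 0 ≤ l / 6 * z := by positivity
    linarith
  refine ⟨X, B, hX, ?_, hB, ?_, ?_⟩
  · have h1 := card_thickening_le (z / 3) X
    rw [hcard] at h1
    have h2 : 2 * (z / 3) + 1 ≤ 1 + z := by omega
    have h3 : (thickening (z / 3) X).card ≤ (S.supp A).ncard * (1 + z) ^ D :=
      h1.trans (Nat.mul_le_mul_left _ (Nat.pow_le_pow_left h2 D))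
    exact_mod_cast h3
  · have hn : ‖S.translate A x t‖ = ‖A‖ := by
      rw [LatticeSystem.translate, S.norm_ι, S.norm_τ]
    have h1 : B = (B - S.translate A x t) + S.translate A x t := by abel
    rw [h1]
    refine (norm_add_le_of_le hBA' hn.le).trans ?_
    have h2 : Real.exp (-(l / 6) * z) * ((L * s + 1) * ‖A‖) ≤ 1 * ((L * s + 1) * ‖A‖) := by
      gcongr
    linarith
  · rw [norm_sub_rev]
    refine hBA'.trans ?_
    gcongr
    norm_num

/-- The moments of space-time translated observables almost factorize at the index that is
separated from the others. -/
theorem exists_norm_moment_sub_le (S : LatticeSystem D 𝔘) {v v₀ L l p q : ℝ} {r : ℕ}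
    {P : MvPolynomial (Fin 2) ℝ} {u : ℝ → ℝ} (hv₀ : 0 < v₀) (hL : 0 < L) (hl : 0 < l)
    (hLR : ∀ (A B : 𝔘) (t : ℝ), S.IsLocal A → S.IsLocal B →
      ‖S.τ t A * B - B * S.τ t A‖ ≤
        L * ‖A‖ * ‖B‖ * (min (S.supp A).ncard (S.supp B).ncard : ℕ) *
          Real.exp (-l * (setDist (S.supp A) (S.supp B) - v₀ * |t|)))
    (hv : 6 * v₀ < v) (hr : P.totalDegree ≤ r) (hp : 0 ≤ p) (hq : q = p - r * D) (hu : 0 < u v)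
    (n : ℕ) :
    ∃ κ : ℝ → ℝ, ∀ s, 1 ≤ s → 0 ≤ κ s ∧ ∀ ω : 𝔘 →L[ℂ] ℂ, IsState ω →
      ThreeElementClustering S ω (6 * v₀) p P u → ∀ A : Fin n → 𝔘, (∀ j, S.IsLocal (A j)) →
      (∀ j, (S.supp (A j)).Nonempty) → ∀ (x : Fin n → Lattice D) (t : Fin n → ℝ) (z : ℕ)
      (i : Fin n), ((∑ j, (S.supp (A j)).ncard : ℕ) : ℝ) ≤ s →
      (∀ j, |t j| ≤ v⁻¹ * z - 1) →
      (∀ j, j ≠ i → z ≤ setDist (S.supp (S.ι (x i) (A i))) (S.supp (S.ι (x j) (A j)))) →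
      ∀ W, i ∈ W →
        ‖moment ω (fun j => S.translate (A j) (x j) (t j)) W -
          moment ω (fun j => S.translate (A j) (x j) (t j)) (W.erase i) *
            moment ω (fun j => S.translate (A j) (x j) (t j)) {i}‖ ≤
        κ s / (1 + z : ℝ) ^ q * ∏ j ∈ W, ((L * s + 2) * ‖A j‖) := by
  have := S.nontrivial
  obtain ⟨E, hE0, hE⟩ := exists_exp_le_div_rpow (c := l / 6) (by positivity) q
  set c := ∑ m ∈ P.support, |P.coeff m| with hcdef
  have hc0 : 0 ≤ c := Finset.sum_nonneg fun _ _ => abs_nonneg _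
  -- The first summand is the clustering error, with `3 ^ p` for the distance reduced to a third;
  -- the second is the approximation error of the two moments, with `E` converting the exponential
  -- into a power.
  refine ⟨fun s => u v * (c * s ^ r) * 3 ^ p + 2 * n * E, fun s hs1 => ⟨by positivity, ?_⟩⟩
  intro ω hω hcl A hA hne x t z i hsum ht hsep W hiW
  have hs0 : 0 ≤ s := zero_le_one.trans hs1
  have hcard : ∀ j, ((S.supp (A j)).ncard : ℝ) ≤ s := fun j => by
    refine le_trans ?_ hsum
    exact_mod_cast Finset.single_le_sum (f := fun j => (S.supp (A j)).ncard)
      (fun _ _ => Nat.zero_le _) (Finset.mem_univ j)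
  choose X B hX hXcard hB hBn hBA using fun j =>
    exists_local_approximants S hv₀ hL hl hLR hv (hA j) (hne j) (x j) (ht j) (hcard j)
  set k := z / 3 with hk
  -- A common region for all approximants other than the `i`-th, so that it contains the products on
  -- both sides of the `i`-th factor.
  set T := (Finset.univ.erase i).biUnion fun j => thickening k (X j) with hT
  set M : ℝ := s * (1 + z : ℝ) ^ D with hM
  have hz1 : (1 : ℝ) ≤ 1 + z := by simp
  have hM1 : 1 ≤ M := one_le_mul_of_one_le_of_one_le hs1 (one_le_pow₀ hz1)
  have hYM : ((thickening k (X i)).card : ℝ) ≤ M := by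
    exact (hXcard i).trans (mul_le_mul_of_nonneg_right (hcard i) (by positivity))
  have hTM : (T.card : ℝ) ≤ M := by
    have h1 : (T.card : ℝ) ≤ ∑ j ∈ Finset.univ.erase i, ((thickening k (X j)).card : ℝ) := by
      exact_mod_cast Finset.card_biUnion_le
    refine h1.trans ((Finset.sum_le_sum fun j _ => hXcard j).trans ?_)
    rw [← Finset.sum_mul]
    refine mul_le_mul_of_nonneg_right (le_trans ?_ hsum) (by positivity)
    push_cast
    exact Finset.sum_le_sum_of_subset_of_nonneg (Finset.erase_subset _ _)
      fun _ _ _ => Nat.cast_nonneg _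
  have hd : ∀ y ∈ thickening k (X i), ∀ y' ∈ T, z - 2 * k ≤ latDist y y' := by
    intro y hy y' hy'
    obtain ⟨a, ha, hay⟩ := mem_thickening.1 hy
    obtain ⟨j, hj, hy'j⟩ := Finset.mem_biUnion.1 hy'
    obtain ⟨a', ha', hay'⟩ := mem_thickening.1 hy'j
    have h1 : z ≤ latDist a a' := by
      refine (hsep j (Finset.ne_of_mem_erase hj)).trans (setDist_le ?_ ?_)
      · rw [← hX i]
        exact ha
      · rw [← hX j]
        exact ha'
    have h2 := latDist_triangle a y a'
    have h3 := latDist_triangle y y' a'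
    rw [latDist_comm y' a'] at h3
    omega
  have hBT : ∀ j, j ≠ i → B j ∈ S.region T := fun j hj =>
    S.region_mono (Finset.subset_biUnion_of_mem (fun j => thickening k (X j))
      (Finset.mem_erase.2 ⟨hj, Finset.mem_univ j⟩)) (hB j)
  have hlist : ∀ m : List (Fin n), i ∉ m → (m.map B).prod ∈ S.region T := by
    intro m hm
    refine list_prod_mem fun y hy => ?_
    obtain ⟨j, hj, rfl⟩ := List.mem_map.1 hy
    exact hBT j fun h => hm (h ▸ hj)
  have hη : u v * (c * M ^ r) / (1 + (z - 2 * k : ℕ) : ℝ) ^ p ≤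
      u v * (c * s ^ r) * 3 ^ p / (1 + z : ℝ) ^ q := by
    have h1 : (1 + z : ℝ) / 3 ≤ 1 + (z - 2 * k : ℕ) := by
      have h : 1 + z ≤ 3 * (1 + (z - 2 * k)) := by omega
      have h' : (1 + z : ℝ) ≤ 3 * (1 + (z - 2 * k : ℕ)) := by exact_mod_cast h
      linarith
    have h2 : (1 + z : ℝ) ^ p = (1 + z : ℝ) ^ q * ((1 + z : ℝ) ^ D) ^ r := by
      -- Here the exponent drops: the region sizes contribute `(1 + z)^(D r)`, and `q + D r = p`.
      rw [← pow_mul, ← Real.rpow_natCast, ← Real.rpow_add (by positivity), hq]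
      congr 1
      push_cast
      ring
    calc _ ≤ u v * (c * M ^ r) / ((1 + z : ℝ) / 3) ^ p := by gcongr
      _ = u v * (c * s ^ r) * 3 ^ p / (1 + z : ℝ) ^ q := by
          rw [Real.div_rpow (by positivity) (by norm_num), h2, hM, mul_pow]
          have h3 : (0 : ℝ) < (1 + z : ℝ) ^ q := by positivity
          have h4 : (0 : ℝ) < 3 ^ p := by positivity
          field_simp
  have hXn : ∀ j, ‖S.translate (A j) (x j) (t j)‖ ≤ (L * s + 2) * ‖A j‖ := by
    intro j
    rw [LatticeSystem.translate, S.norm_ι, S.norm_τ]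
    have h1 : 1 ≤ L * s + 2 := by
      have : 0 ≤ L * s := by positivity
      linarith
    exact le_mul_of_one_le_left (norm_nonneg _) h1
  have hmain := norm_moment_sub_le hω (X := fun j => S.translate (A j) (x j) (t j)) (X' := B)
    (b := fun j => (L * s + 2) * ‖A j‖) (i := i) (Real.exp_nonneg _) hXn hBn hBA
    (fun l₁ l₂ h₁ h₂ => hcl.norm_sub_le hω hv (by linarith) hu hr hp hd hM1 hYM hTM
      (hlist l₁ h₁) (hB i) (hlist l₂ h₂)) (by positivity) hiW
  refine hmain.trans (mul_le_mul_of_nonneg_right ?_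
    (Finset.prod_nonneg fun j _ => by positivity))
  rw [add_div]
  refine add_le_add hη ?_
  rw [mul_div_assoc]
  exact mul_le_mul_of_nonneg_left (hE z) (by positivity)

end QSL

theorem mainTheorem6 {D : ℕ} {𝔘 : Type*} [CStarAlgebra 𝔘] (S : QSL.ShortRangeSystem D 𝔘) :
    ∃ vLR : ℝ, QSL.IsLiebRobinsonVelocity S.toLatticeSystem vLR ∧
      ∀ (p : ℝ) (r : ℕ) (P : MvPolynomial (Fin 2) ℝ) (u : ℝ → ℝ),
        P.totalDegree ≤ r → 1 < p - r * D → (∀ v, vLR < v → 0 < u v) →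
        ∀ n : ℕ, 2 ≤ n → ∀ v : ℝ, vLR < v →
          ∃ K : (Fin n → ℕ) → ℝ, ∀ ω : 𝔘 →L[ℂ] ℂ, QSL.IsState ω →
            QSL.ThreeElementClustering S.toLatticeSystem ω vLR p P u →
            ∀ A : Fin n → 𝔘, (∀ i, S.IsLocal (A i)) → (∀ i, (S.supp (A i)).Nonempty) →
            ∀ (x : Fin n → QSL.Lattice D) (t : Fin n → ℝ),
              (∀ k, |t k| ≤ v⁻¹ * (S.separation A x : ℝ) - 1) →
              ‖QSL.classicalCumulant ω (fun i => S.translate (A i) (x i) (t i))‖ ≤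
                  K (fun i => (S.supp (A i)).ncard) * (∏ i, ‖A i‖) /
                    (1 + (S.separation A x : ℝ)) ^ (p - r * D) ∧
              ‖QSL.freeCumulant ω (fun i => S.translate (A i) (x i) (t i))‖ ≤
                  K (fun i => (S.supp (A i)).ncard) * (∏ i, ‖A i‖) /
                    (1 + (S.separation A x : ℝ)) ^ (p - r * D) := by
  obtain ⟨v₀, hLRV⟩ := S.exists_isLiebRobinsonVelocity
  have hLRV' := hLRV
  obtain ⟨hv₀, L, l, hL, hl, hLR⟩ := hLRV'
  -- Any larger number is again a Lieb–Robinson velocity; the factor `6` leaves room for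
  -- localisation within a third of the separation.
  refine ⟨6 * v₀, hLRV.mono (by linarith), ?_⟩
  intro p r P u hr hp hu n hn v hv
  have hp0 : 0 ≤ p := by
    have : (0 : ℝ) ≤ r * D := by positivity
    linarith
  obtain ⟨κ, hκ⟩ := QSL.exists_norm_moment_sub_le S.toLatticeSystem hv₀ hL hl hLR hv hr hp0 rfl
    (hu v hv) n
  have huniv : ∀ i : Fin n, (Finset.univ : Finset (Fin n)) ≠ {i} := fun i h => by
    have := congrArg Finset.card h
    rw [Finset.card_fin, Finset.card_singleton] at this
    omega
  choose C hC0 hC using fun i : Fin n => QSL.exists_norm_classicalCumulant_le 𝔘 hn i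
  choose C' hC0' hC' using fun i : Fin n =>
    QSL.exists_norm_freeCumulantOn_le_mul 𝔘 i Finset.univ (Finset.mem_univ i) (huniv i)
  -- The isolated index depends on the observables and positions, so the combinatorial constants are
  -- summed over all indices. The sum of the support sizes serves as the bound `s` for all regions.
  refine ⟨fun m => (∑ i, (C i + C' i)) * κ (∑ j, m j : ℕ) * (L * (∑ j, m j : ℕ) + 2) ^ n, ?_⟩
  intro ω hω hcl A hA hne x t ht
  obtain ⟨i, hi⟩ := S.exists_separation_le (by omega) A x
  set z := S.separation A x with hz
  set s : ℝ := ((∑ j, (S.supp (A j)).ncard : ℕ) : ℝ) with hs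
  have hs1 : 1 ≤ s := by
    have h1 : 1 ≤ (S.supp (A i)).ncard :=
      (Set.ncard_pos (hA i).finite_supp).2 (hne i)
    have h2 : (S.supp (A i)).ncard ≤ ∑ j, (S.supp (A j)).ncard :=
      Finset.single_le_sum (f := fun j => (S.supp (A j)).ncard) (fun _ _ => Nat.zero_le _)
        (Finset.mem_univ i)
    exact Nat.one_le_cast.2 (h1.trans h2)
  obtain ⟨hκ0, hfac⟩ := hκ s hs1
  have hfac' := hfac ω hω hcl A hA hne x t z i le_rfl ht hi
  have hb : ∀ j, 0 ≤ (L * s + 2) * ‖A j‖ := fun j => by positivity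
  have hm : ∀ W, ‖QSL.moment ω (fun j => S.translate (A j) (x j) (t j)) W‖ ≤
      ∏ j ∈ W, ((L * s + 2) * ‖A j‖) := by
    intro W
    have := S.nontrivial
    rw [← QSL.prod_map_sort]
    refine (hω.norm_apply_le _).trans (QSL.norm_list_prod_le (fun j => ?_) _)
    rw [QSL.LatticeSystem.translate, S.norm_ι, S.norm_τ]
    have h1 : 1 ≤ L * s + 2 := by
      have : 0 ≤ L * s := by positivity
      linarith
    exact le_mul_of_one_le_left (norm_nonneg _) h1
  have hprod : ∏ j, ((L * s + 2) * ‖A j‖) = (L * s + 2) ^ n * ∏ j, ‖A j‖ := by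
    rw [Finset.prod_mul_distrib, Finset.prod_const, Finset.card_fin]
  have hfinal : ∀ c : ℝ, c ≤ ∑ i, (C i + C' i) →
      c * (κ s / (1 + z : ℝ) ^ (p - r * D)) * ∏ j, ((L * s + 2) * ‖A j‖) ≤
        (∑ i, (C i + C' i)) * κ s * (L * s + 2) ^ n * (∏ j, ‖A j‖) /
          (1 + z : ℝ) ^ (p - r * D) := by
    intro c hc
    rw [hprod]
    calc _ ≤ (∑ i, (C i + C' i)) * (κ s / (1 + z : ℝ) ^ (p - r * D)) *
          ((L * s + 2) ^ n * ∏ j, ‖A j‖) := by gcongr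
      _ = _ := by ring
  have hCi : C i + C' i ≤ ∑ i, (C i + C' i) :=
    Finset.single_le_sum (f := fun i => C i + C' i) (fun i _ => add_nonneg (hC0 i) (hC0' i))
      (Finset.mem_univ i)
  constructor
  · exact (hC i ω _ _ _ hm hfac').trans (hfinal _ (by linarith [hC0' i]))
  · exact (hC' i ω _ _ _ (by positivity) hb hm hfac').trans (hfinal _ (by linarith [hC0 i]))
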